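/- **Model.** A platform interacts with $N\ge 2$ users whose thresholds $\theta_1,\dots,\theta_N\in(0,1)$ are independent with distribution function $F$, where $L_c(y-x)\le F(y)-F(x)\le L_h(y-x)$ for $0\le x\le y\le 1$ and $0<L_c\le L_h$. An action $y\in[0,1]$ on user $n$ earns $r(y)$ if $y\le\theta_n$; otherwise it earns $0$ and costs one unit of the user's patience budget, which is initially the integer $B\ge 1$; the user leaves when the residual budget becomes negative. Rewards are discounted by $\gamma\in[0,1)$ per interaction. The function $r$ is nonnegative, non-decreasing, $L_r$-Lipschitz and at most $r_{\max}$ on $[0,1]$. Under hard feedback, the platform observes $\mathbf 1(y\le\theta_n)$ after each action. A state is $(\ell,u,b)$, where $[\ell,u]$ is the interval known to contain the threshold and $b$ is the residual budget. **Benchmark.** Let $V^*$ be the bounded solution of $V^*(\ell,u,b)=\max_{\ell\le y\le u}\{P(y|\ell,u)(r(y)+\gamma V^*(y,u,b))+(1-P(y|\ell,u))\gamma V^*(\ell,y,b-1)\}$ for $\ell<u$, $b\ge0$, with $V^*=0$ for $b<0$ and $P(y|\ell,u)=\frac{F(u)-F(y)}{F(u)-F(\ell)}$. For $\delta>0$,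 the $\delta$-policy plays a maximizer if $u-\ell>\delta$ and $\ell$ otherwise; $V^*_\delta(0,1,B)$ is its expected reward from one user. **Algorithm (UCB-PVI-HF).** Fix an integer $\phi\ge2$ and $\epsilon\in(0,1)$ and put $\eta_K=\sqrt{18\log(16/\epsilon)/K}$. On each user of an exploration set $\mathcal L$, starting from $[\ell,u]=[0,1]$, as long as $u-\ell>\beta$, play $\ell,\ell+I,\dots,\ell+\phi I=u$, $I=(u-\ell)/\phi$, one after the other until the first negative feedback, set $\ell$ to the last accepted and $u$ to the rejected action, and repeat; once $u-\ell\le\beta$, play $\ell$ forever. Let $[\ell_n,u_n]$ be the final interval of user $n\in\mathcal L$, $K=\#\{n\in\mathcal L:u_n-\ell_n\le\beta\}$, and $\hat F(x)=\#\{n\in\mathcal L:u_n-\ell_n\le\beta,\ \ell_n\le x\}/K$. Put $$P_U(y|\ell,u)=\frac{\hat F(u)-\hat F(y)}{\max\{\hat F(u)-\hat F(\ell),L_c(u-\ell)\}}+\frac{2(\eta_K+2\beta L_h)}{L_c\delta},$$ and let $\hat V$ be a bounded solution of $\hat V=0$ for $b<0$; $\hat V(\ell,u,b)=r(\ell)/(1-\gamma)$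 for $b\ge 0$, $u-\ell\le\delta$; and $\hat V(\ell,u,b)=\sup_{\ell\le y\le u}\{P_U(y|\ell,u)(r(y)+\gamma\hat V(y,u,b))+(1-P_U(y|\ell,u))\gamma\hat V(\ell,y,b-1)\}$ for $b\ge0$, $u-\ell>\delta$. On every other user, play in state $(\ell,u,b)$ the action $\ell$ if $u-\ell\le\delta$, and otherwise a $y\in[\ell,u]$ that attains this supremum up to an error of at most $N^{-1/3}$ (any $y\in[\ell,u]$, if the confidence widths are so large that there is no $\hat V$). **Theorem.** Let $\tilde\lambda\in[0,\bar\lambda]$ with $\bar\lambda<1$, let $|\mathcal L|\in\{1,\dots,N\}$ equal $$\frac{(\log(16/\epsilon))^{1/2}N^{2/3}(1-\tilde\lambda)^{1/2}}{B^{1/3}}$$ up to rounding to a neighbouring integer, let $\beta=\eta_{|\mathcal L|}/(2L_h)$, and suppose $\beta<1$ and $\log_\phi(1/\beta)+1\le B$. There is a constant $M$ that depends only on $\gamma,\delta,\epsilon,\phi,L_r,L_c,L_h,r_{\max},\bar\lambda$ (not on $N,B,F,r$) such that, with probability at least $1-\epsilon$ over the exploration users, the $\delta$-regret of UCB-PVI-HF,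 i.e. $N V^*_\delta(0,1,B)$ minus its expected total reward given the exploration data, satisfies $$R_\delta(N)\le M\,N^{2/3}B^{1/6}(\log N)^{2/3}.$$ The same holds if the reward of the exploration users is replaced by its expectation. In particular $R_\delta(N)=\tilde O(N^{2/3})$ whenever $B$ is at most polylogarithmic in $N$. -/

import Mathlib

open MeasureTheory ProbabilityTheory Set

namespace SeqChoice

/-! ### The model -/

/-- A reward function on `[0,1]`: nonnegative, bounded by `rmax`, non-decreasing and
`Lr`-Lipschitz. -/
structure IsReward (r : ℝ → ℝ) (Lr rmax : ℝ) : Prop where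
  nonneg : ∀ y ∈ Icc (0 : ℝ) 1, 0 ≤ r y
  le_max : ∀ y ∈ Icc (0 : ℝ) 1, r y ≤ rmax
  mono : MonotoneOn r (Icc (0 : ℝ) 1)
  lipschitz : ∀ x ∈ Icc (0 : ℝ) 1, ∀ y ∈ Icc (0 : ℝ) 1, x ≤ y → r y - r x ≤ Lr * (y - x)

/-- The law of a user's threshold: it lives on `(0,1)` and its distribution function `F`
satisfies `Lc (y - x) ≤ F y - F x ≤ Lh (y - x)` for `0 ≤ x ≤ y ≤ 1`. -/
structure IsThresholdLaw (μ : Measure ℝ) (Lc Lh : ℝ) : Prop where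
  support : μ (Ioo (0 : ℝ) 1)ᶜ = 0
  lower : ∀ x ∈ Icc (0 : ℝ) 1, ∀ y ∈ Icc (0 : ℝ) 1, x ≤ y → Lc * (y - x) ≤ cdf μ y - cdf μ x
  upper : ∀ x ∈ Icc (0 : ℝ) 1, ∀ y ∈ Icc (0 : ℝ) 1, x ≤ y → cdf μ y - cdf μ x ≤ Lh * (y - x)

/-- The discounted reward of one user with threshold `θ`, where `y t` is the action and `b t` the
residual budget (before the action) at the `t`-th interaction, `t = 0, 1, …`. The user is present
as long as the residual budget is nonnegative. -/
noncomputable def discountedReward (γ : ℝ) (r : ℝ → ℝ) (θ : ℝ) (y : ℕ → ℝ) (b : ℕ → ℤ) : ℝ :=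
  ∑' t : ℕ, if 0 ≤ b t ∧ y t ≤ θ then γ ^ t * r (y t) else 0

/-- A state of the decision process: uncertainty interval `[lo, up]`, residual budget. -/
structure UIState where
  lo : ℝ
  up : ℝ
  budget : ℤ

/-- The uncertainty interval is a subinterval of `[0,1]`. -/
def UIState.Valid (s : UIState) : Prop := 0 ≤ s.lo ∧ s.lo ≤ s.up ∧ s.up ≤ 1

/-- Hard feedback: after action `y` it is observed whether `y ≤ θ`. A positive feedback raises the
lower end to `y`; a negative one lowers the upper end to `y` and costs one unit of budget. -/
noncomputable def UIState.next (θ : ℝ) (s : UIState) (y : ℝ) : UIState :=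
  if y ≤ θ then ⟨y, s.up, s.budget⟩ else ⟨s.lo, y, s.budget - 1⟩

/-- The states visited by a stationary policy `π` on a user with threshold `θ`, budget `B`. -/
noncomputable def policyState (π : UIState → ℝ) (B : ℕ) (θ : ℝ) : ℕ → UIState
  | 0 => ⟨0, 1, B⟩
  | t + 1 => (policyState π B θ t).next θ (π (policyState π B θ t))

/-- Total discounted reward of policy `π` from a user with threshold `θ`. -/
noncomputable def policyReward (γ : ℝ) (r : ℝ → ℝ) (π : UIState → ℝ) (B : ℕ) (θ : ℝ) : ℝ :=
  discountedReward γ r θ (fun t => π (policyState π B θ t)) (fun t => (policyState π B θ t).budget)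

/-! ### The oracle and the `δ`-policy -/

/-- The right-hand side of the Bellman equation at state `s` and action `y`, for a value function
`V` and probability `p` of a positive feedback. -/
noncomputable def bellmanQ (γ : ℝ) (r : ℝ → ℝ) (V : UIState → ℝ) (s : UIState) (y p : ℝ) : ℝ :=
  p * (r y + γ * V ⟨y, s.up, s.budget⟩) + (1 - p) * (γ * V ⟨s.lo, y, s.budget - 1⟩)

/-- `P(y | ℓ, u) = (F u - F y) / (F u - F ℓ)`. -/
noncomputable def condProb (F : ℝ → ℝ) (s : UIState) (y : ℝ) : ℝ :=
  (F s.up - F y) / (F s.up - F s.lo)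

/-- `V` is the optimal value function of the decision process when the distribution function of
the thresholds is `F`. -/
structure IsOptimalValue (γ : ℝ) (r : ℝ → ℝ) (F : ℝ → ℝ) (V : UIState → ℝ) : Prop where
  bounded : ∃ C : ℝ, ∀ s : UIState, s.Valid → |V s| ≤ C
  abandoned : ∀ s : UIState, s.Valid → s.budget < 0 → V s = 0
  bellman : ∀ s : UIState, s.Valid → s.lo < s.up → 0 ≤ s.budget →
    IsGreatest ((fun y => bellmanQ γ r V s y (condProb F s y)) '' Icc s.lo s.up) (V s)

/-- `y` selects in every nondegenerate state an optimal action, with respect to the optimal value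
function `V`. -/
def IsOptimalAction (γ : ℝ) (r : ℝ → ℝ) (F : ℝ → ℝ) (V : UIState → ℝ) (y : UIState → ℝ) : Prop :=
  ∀ s : UIState, s.Valid → s.lo < s.up → 0 ≤ s.budget →
    y s ∈ Icc s.lo s.up ∧ bellmanQ γ r V s (y s) (condProb F s (y s)) = V s

/-- Use `y` when the uncertainty interval is longer than `δ`, otherwise its lower end. -/
noncomputable def deltaPolicy (δ : ℝ) (y : UIState → ℝ) (s : UIState) : ℝ :=
  if δ < s.up - s.lo then y s else s.lo

/-- Expected reward `V_δ(0,1,B)` of the `δ`-policy built on the optimal actions `y`. -/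
noncomputable def deltaValue (γ δ : ℝ) (r : ℝ → ℝ) (μ : Measure ℝ) (y : UIState → ℝ) (B : ℕ) : ℝ :=
  ∫ θ, policyReward γ r (deltaPolicy δ y) B θ ∂μ

/-! ### Exploration users: repeated linear search -/

/-- State of the linear search: current uncertainty interval `[lo, up]`; the interval
`[base, top]` with which the current round started; the number `k` of actions already performed
in this round (`k = 0`: a new round is about to start); residual budget. -/
structure SearchState where
  lo : ℝ
  up : ℝ
  base : ℝ
  top : ℝ
  k : ℕ
  budget : ℤ

/-- No new round is started, as the uncertainty interval has length at most `β`. -/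
def SearchState.Resting (β : ℝ) (s : SearchState) : Prop := s.k = 0 ∧ s.up - s.lo ≤ β

open Classical in
/-- The action: `lo` when resting, otherwise the `k`-th point of the grid
`base, base + I, …, base + φ I = top`, `I = (top - base) / φ`. -/
noncomputable def SearchState.action (φ : ℕ) (β : ℝ) (s : SearchState) : ℝ :=
  if s.Resting β then s.lo else s.base + s.k * ((s.top - s.base) / φ)

open Classical in
/-- One action of the search. A negative feedback ends the round, as does the last grid point. -/
noncomputable def SearchState.next (φ : ℕ) (β θ : ℝ) (s : SearchState) : SearchState :=
  if s.Resting β then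
    { s with budget := if s.action φ β ≤ θ then s.budget else s.budget - 1 }
  else if s.action φ β ≤ θ then
    if s.k = φ then ⟨s.action φ β, s.up, s.action φ β, s.up, 0, s.budget⟩
    else ⟨s.action φ β, s.up, s.base, s.top, s.k + 1, s.budget⟩
  else ⟨s.lo, s.action φ β, s.lo, s.action φ β, 0, s.budget - 1⟩

/-- The states of the search on a user with threshold `θ` and budget `B`. -/
noncomputable def searchState (φ : ℕ) (β : ℝ) (B : ℕ) (θ : ℝ) : ℕ → SearchState
  | 0 => ⟨0, 1, 0, 1, 0, B⟩
  | t + 1 => (searchState φ β B θ t).next φ β θ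

/-- Total discounted reward from an exploration user with threshold `θ`. -/
noncomputable def searchReward (γ : ℝ) (r : ℝ → ℝ) (φ : ℕ) (β : ℝ) (B : ℕ) (θ : ℝ) : ℝ :=
  discountedReward γ r θ (fun t => (searchState φ β B θ t).action φ β)
    (fun t => (searchState φ β B θ t).budget)

/-- The state at the first time when the user has abandoned or the search rests; its uncertainty
interval is the final one. -/
noncomputable def finalState (φ : ℕ) (β : ℝ) (B : ℕ) (θ : ℝ) : SearchState :=
  searchState φ β B θ
    (sInf {t : ℕ | (searchState φ β B θ t).budget < 0 ∨ (searchState φ β B θ t).Resting β})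

/-- The final uncertainty interval has length at most `β`. -/
def Located (φ : ℕ) (β : ℝ) (B : ℕ) (θ : ℝ) : Prop :=
  (finalState φ β B θ).up - (finalState φ β B θ).lo ≤ β

open Classical in
/-- The number `K` of located exploration users. -/
noncomputable def locatedCount (φ : ℕ) (β : ℝ) (B : ℕ) {L : ℕ} (θ : Fin L → ℝ) : ℕ :=
  (Finset.univ.filter fun n => Located φ β B (θ n)).card

open Classical in
/-- The empirical distribution function `F̂` built on the lower ends of the final intervals of the
located exploration users. -/
noncomputable def empCdf (φ : ℕ) (β : ℝ) (B : ℕ) {L : ℕ} (θ : Fin L → ℝ) (x : ℝ) : ℝ :=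
  ((Finset.univ.filter fun n => Located φ β B (θ n) ∧ (finalState φ β B (θ n)).lo ≤ x).card : ℝ) /
    locatedCount φ β B θ

/-! ### Exploitation users: optimistic planning -/

/-- `η_K = √(18 log(16/ε) / K)`. -/
noncomputable def eta (ε : ℝ) (K : ℕ) : ℝ := √(18 * Real.log (16 / ε) / K)

/-- Upper confidence bound `P_U(y | ℓ, u)` for the probability of a positive feedback, for an
estimate `Fh` of the distribution function and `η = η_K`. -/
noncomputable def ucbProb (Fh : ℝ → ℝ) (η β δ Lc Lh : ℝ) (s : UIState) (y : ℝ) : ℝ :=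
  (Fh s.up - Fh y) / max (Fh s.up - Fh s.lo) (Lc * (s.up - s.lo)) +
    2 * (η + 2 * β * Lh) / (Lc * δ)

/-- `V` is an optimistic value function for the probabilities `P`. On intervals of length at most
`δ` the lower end is played forever. On longer ones the Bellman equation holds; the lower
confidence bound for a negative feedback is `1 - P s y`. -/
structure IsOptimisticValue (γ δ : ℝ) (r : ℝ → ℝ) (P : UIState → ℝ → ℝ) (V : UIState → ℝ) :
    Prop where
  bounded : ∃ C : ℝ, ∀ s : UIState, s.Valid → |V s| ≤ C
  abandoned : ∀ s : UIState, s.Valid → s.budget < 0 → V s = 0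
  conservative : ∀ s : UIState, s.Valid → 0 ≤ s.budget → s.up - s.lo ≤ δ → V s = r s.lo / (1 - γ)
  bellman : ∀ s : UIState, s.Valid → 0 ≤ s.budget → δ < s.up - s.lo →
    IsLUB ((fun y => bellmanQ γ r V s y (P s y)) '' Icc s.lo s.up) (V s)

/-- `y` is a choice of actions of the optimistic planner on intervals longer than `δ`: up to `τ`,
it maximizes the optimistic value (`τ = 0`: exact maximizers). Where the confidence bounds are so
wide that the optimistic Bellman equations have no bounded solution, any actions in the
uncertainty interval are allowed. -/
def IsPlannedAction (γ δ τ : ℝ) (r : ℝ → ℝ) (P : UIState → ℝ → ℝ) (y : UIState → ℝ) : Prop :=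
  (∀ s : UIState, s.Valid → 0 ≤ s.budget → δ < s.up - s.lo → y s ∈ Icc s.lo s.up) ∧
  ((∃ V, IsOptimisticValue γ δ r P V) → ∃ V, IsOptimisticValue γ δ r P V ∧
    ∀ s : UIState, s.Valid → 0 ≤ s.budget → δ < s.up - s.lo →
      V s - τ ≤ bellmanQ γ r V s (y s) (P s (y s)))

/-- The action maps that the algorithm may use on the exploitation users after it has explored
users with thresholds `θ`. -/
def IsUCBPVIAction (γ δ ε τ Lc Lh : ℝ) (r : ℝ → ℝ) (φ : ℕ) (β : ℝ) (B : ℕ) {L : ℕ}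
    (θ : Fin L → ℝ) (y : UIState → ℝ) : Prop :=
  IsPlannedAction γ δ τ r
    (ucbProb (empCdf φ β B θ) (eta ε (locatedCount φ β B θ)) β δ Lc Lh) y

/-! ### Regret -/

/-- The `δ`-regret over `N` users, `L` of which are explored and contribute `W`, while the others
are treated by the policy `π`: `N V_δ(0,1,B)` minus the expected total reward, the expectation being
over the thresholds of the `N - L` exploitation users. -/
noncomputable def deltaRegret (γ δ : ℝ) (r : ℝ → ℝ) (μ : Measure ℝ) (ystar : UIState → ℝ)
    (N L B : ℕ) (W : ℝ) (π : UIState → ℝ) : ℝ :=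
  N * deltaValue γ δ r μ ystar B -
    ∫ θ : Fin (N - L) → ℝ, (W + ∑ n, policyReward γ r π B (θ n)) ∂(Measure.pi fun _ => μ)

end SeqChoice

open SeqChoice

namespace SeqChoice

/-! ### Policies started from an arbitrary state -/

/-! An explored user costs at most `rmax / (1 - γ)`, the most that any user can yield. Every other
user costs at most `τ / (1 - γ)` plus a multiple of the accuracy `κ` of the bound `P_U`. Since `κ`
is of order `√(log N / L)`, the regret is of order `L + N τ + N √(log N / L)`, and `L` of order
`N^(2/3) / B^(1/3)` gives the rate.

Loss per user (`deltaValue_sub_le`): the optimistic value is compared with the rewards of both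
`δ`-policies. Values are multiplied by the mass of the cell `[ℓ, u)`. The rewards integrated over a
cell obey a Bellman recursion without division (`cellReward_step`), and mass is additive when a cell
splits, so an error of `A` times the mass per interaction adds up to at most `A / (1 - γ)`, whatever
the budget (`le_of_discounted_step`). The inequality `P_U ≥ P` is not needed; two-sided closeness
`|P_U - P| ≤ κ` is enough. `P_U` may leave `[0,1]`, but for `κ ≤ (1 - γ) / 4` the optimistic Bellman
operator is still a contraction, so its value exists and is bounded by a constant. For larger `κ`
the trivial loss `rmax / (1 - γ)` is itself at most a multiple of `κ`.

Accuracy: the budget condition lets the search locate every threshold up to `β` before the user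
leaves (`finalState_spec`), so `K = L` and the estimate lies between the sample distribution
function at `x` and at `x + β`. Hoeffding's inequality at the points `i / L`, a union bound,
monotonicity and the Lipschitz bound on `F` make this uniform in `x` (`abs_empCdf_sub_le`). The
cut-off `δ` keeps the denominators of the conditional probabilities above `Lc δ`
(`abs_ucbProb_sub_condProb_le`). -/

/-- The states visited by the stationary policy `π` from the initial state `s`. -/
noncomputable def stateFrom (π : UIState → ℝ) (s : UIState) (θ : ℝ) : ℕ → UIState
  | 0 => s
  | t + 1 => (stateFrom π s θ t).next θ (π (stateFrom π s θ t))

/-- Total discounted reward of the stationary policy `π` from the initial state `s`. -/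
noncomputable def rewardFrom (γ : ℝ) (r : ℝ → ℝ) (π : UIState → ℝ) (s : UIState) (θ : ℝ) : ℝ :=
  discountedReward γ r θ (fun t => π (stateFrom π s θ t)) (fun t => (stateFrom π s θ t).budget)

theorem policyState_eq_stateFrom (π : UIState → ℝ) (B : ℕ) (θ : ℝ) (t : ℕ) :
    policyState π B θ t = stateFrom π ⟨0, 1, B⟩ θ t := by
  induction t with
  | zero => rfl
  | succ t ih => simp only [policyState, stateFrom, ih]

theorem policyReward_eq_rewardFrom (γ : ℝ) (r : ℝ → ℝ) (π : UIState → ℝ) (B : ℕ) (θ : ℝ) :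
    policyReward γ r π B θ = rewardFrom γ r π ⟨0, 1, B⟩ θ := by
  simp only [policyReward, rewardFrom, policyState_eq_stateFrom]

theorem stateFrom_succ' (π : UIState → ℝ) (s : UIState) (θ : ℝ) (t : ℕ) :
    stateFrom π s θ (t + 1) = stateFrom π (s.next θ (π s)) θ t := by
  induction t with
  | zero => rfl
  | succ t ih => rw [stateFrom, ih, stateFrom]

/-- As long as the user is present, the policy acts within the uncertainty interval. -/
def Admissible (π : UIState → ℝ) : Prop :=
  ∀ s : UIState, s.Valid → 0 ≤ s.budget → π s ∈ Icc s.lo s.up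

theorem UIState.budget_next_le (θ : ℝ) (s : UIState) (y : ℝ) :
    (s.next θ y).budget ≤ s.budget := by
  unfold UIState.next; split_ifs <;> simp

theorem UIState.Valid.accept {s : UIState} (hs : s.Valid) {y : ℝ} (hy : y ∈ Icc s.lo s.up) :
    UIState.Valid ⟨y, s.up, s.budget⟩ :=
  ⟨hs.1.trans hy.1, hy.2, hs.2.2⟩

theorem UIState.Valid.reject {s : UIState} (hs : s.Valid) {y : ℝ} (hy : y ∈ Icc s.lo s.up) :
    UIState.Valid ⟨s.lo, y, s.budget - 1⟩ :=
  ⟨hs.1, hy.1, hy.2.trans hs.2.2⟩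

theorem UIState.Valid.mem_unit {s : UIState} (hs : s.Valid) {y : ℝ} (hy : y ∈ Icc s.lo s.up) :
    y ∈ Icc (0 : ℝ) 1 :=
  ⟨hs.1.trans hy.1, hy.2.trans hs.2.2⟩

theorem UIState.Valid.lo_mem {s : UIState} (hs : s.Valid) : s.lo ∈ Icc s.lo s.up :=
  ⟨le_rfl, hs.2.1⟩

theorem stateFrom_valid {π : UIState → ℝ} (hπ : Admissible π) {s : UIState} (hs : s.Valid)
    (θ : ℝ) (t : ℕ) (hb : 0 ≤ (stateFrom π s θ t).budget) : (stateFrom π s θ t).Valid := by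
  induction t with
  | zero => exact hs
  | succ t ih =>
    have h0 : 0 ≤ (stateFrom π s θ t).budget := hb.trans (UIState.budget_next_le _ _ _)
    have hv := ih h0
    have hy := hπ _ hv h0
    rw [stateFrom, UIState.next]
    split_ifs
    exacts [hv.accept hy, hv.reject hy]

theorem IsReward.rmax_nonneg {r : ℝ → ℝ} {Lr rmax : ℝ} (hr : IsReward r Lr rmax) : 0 ≤ rmax :=
  (hr.nonneg 0 (by simp)).trans (hr.le_max 0 (by simp))

section

variable {γ Lr rmax : ℝ} {r : ℝ → ℝ} {π : UIState → ℝ} {s : UIState}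

theorem reward_term_mem (hγ0 : 0 ≤ γ) (hr : IsReward r Lr rmax) (hπ : Admissible π)
    (hs : s.Valid) (θ : ℝ) (t : ℕ) :
    (if 0 ≤ (stateFrom π s θ t).budget ∧ π (stateFrom π s θ t) ≤ θ then
      γ ^ t * r (π (stateFrom π s θ t)) else 0) ∈ Icc 0 (γ ^ t * rmax) := by
  have := hr.rmax_nonneg
  split_ifs with h
  · have hv := stateFrom_valid hπ hs θ t h.1
    have hy := hv.mem_unit (hπ _ hv h.1)
    have h1 := hr.nonneg _ hy
    have h2 := hr.le_max _ hy
    exact ⟨by positivity, by gcongr⟩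
  · exact ⟨le_rfl, by positivity⟩

theorem summable_reward (hγ0 : 0 ≤ γ) (hγ1 : γ < 1) (hr : IsReward r Lr rmax) (hπ : Admissible π)
    (hs : s.Valid) (θ : ℝ) :
    Summable fun t => if 0 ≤ (stateFrom π s θ t).budget ∧ π (stateFrom π s θ t) ≤ θ then
      γ ^ t * r (π (stateFrom π s θ t)) else 0 :=
  Summable.of_nonneg_of_le (fun t => (reward_term_mem hγ0 hr hπ hs θ t).1)
    (fun t => (reward_term_mem hγ0 hr hπ hs θ t).2)
    ((summable_geometric_of_lt_one hγ0 hγ1).mul_right _)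

theorem rewardFrom_nonneg (hγ0 : 0 ≤ γ) (hr : IsReward r Lr rmax) (hπ : Admissible π)
    (hs : s.Valid) (θ : ℝ) : 0 ≤ rewardFrom γ r π s θ :=
  tsum_nonneg fun t => (reward_term_mem hγ0 hr hπ hs θ t).1

theorem rewardFrom_le (hγ0 : 0 ≤ γ) (hγ1 : γ < 1) (hr : IsReward r Lr rmax) (hπ : Admissible π)
    (hs : s.Valid) (θ : ℝ) : rewardFrom γ r π s θ ≤ rmax / (1 - γ) := by
  have h := (summable_reward hγ0 hγ1 hr hπ hs θ).tsum_le_tsum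
    (fun t => (reward_term_mem hγ0 hr hπ hs θ t).2)
    ((summable_geometric_of_lt_one hγ0 hγ1).mul_right _)
  rw [tsum_mul_right, tsum_geometric_of_lt_one hγ0 hγ1] at h
  rw [div_eq_inv_mul]
  exact h

theorem rewardFrom_step (hγ0 : 0 ≤ γ) (hγ1 : γ < 1) (hr : IsReward r Lr rmax) (hπ : Admissible π)
    (hs : s.Valid) (θ : ℝ) :
    rewardFrom γ r π s θ = (if 0 ≤ s.budget ∧ π s ≤ θ then r (π s) else 0) +
      γ * rewardFrom γ r π (s.next θ (π s)) θ := by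
  rw [rewardFrom, discountedReward, (summable_reward hγ0 hγ1 hr hπ hs θ).tsum_eq_zero_add,
    rewardFrom, discountedReward, ← tsum_mul_left]
  congr 1
  · simp [stateFrom]
  · refine tsum_congr fun t => ?_
    simp only [stateFrom_succ']
    split_ifs
    · ring
    · simp

theorem rewardFrom_of_budget_neg (hb : s.budget < 0) (θ : ℝ) : rewardFrom γ r π s θ = 0 := by
  have h : ∀ t, (stateFrom π s θ t).budget < 0 := by
    intro t
    induction t with
    | zero => exact hb
    | succ t ih => exact (UIState.budget_next_le _ _ _).trans_lt ih
  rw [rewardFrom, discountedReward]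
  simp [(h _).not_ge]

/-- The policy is an arbitrary function, so measurability cannot come from composition. From a fixed
state, however, the first action is a constant and the next state takes only two values, according
to whether `θ` lies in a half-line; induction on time, for all initial states at once, does the
rest. -/
theorem measurable_comp_stateFrom {g : UIState → ℝ → ℝ} (hg : ∀ s, Measurable (g s)) (t : ℕ)
    (s : UIState) : Measurable fun θ => g (stateFrom π s θ t) θ := by
  induction t generalizing s with
  | zero => exact hg s
  | succ t ih =>
    simp only [stateFrom_succ', UIState.next]
    have : (fun θ => g (stateFrom π (if π s ≤ θ then ⟨π s, s.up, s.budget⟩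
        else ⟨s.lo, π s, s.budget - 1⟩) θ t) θ) = fun θ => if π s ≤ θ then
        g (stateFrom π ⟨π s, s.up, s.budget⟩ θ t) θ else
        g (stateFrom π ⟨s.lo, π s, s.budget - 1⟩ θ t) θ := by
      ext θ; split_ifs <;> rfl
    rw [this]
    exact Measurable.ite measurableSet_Ici (ih _) (ih _)

theorem measurable_rewardFrom (hγ0 : 0 ≤ γ) (hγ1 : γ < 1) (hr : IsReward r Lr rmax)
    (hπ : Admissible π) (hs : s.Valid) : Measurable (rewardFrom γ r π s) := by
  refine measurable_of_tendsto_metrizable (f := fun n θ => ∑ t ∈ Finset.range n,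
    if 0 ≤ (stateFrom π s θ t).budget ∧ π (stateFrom π s θ t) ≤ θ then
      γ ^ t * r (π (stateFrom π s θ t)) else 0) (fun n => ?_) ?_
  · refine Finset.measurable_fun_sum _ fun t _ => ?_
    refine measurable_comp_stateFrom (π := π)
      (g := fun s θ => if 0 ≤ s.budget ∧ π s ≤ θ then γ ^ t * r (π s) else 0) (fun s => ?_) t s
    exact Measurable.ite ((MeasurableSet.const _).inter measurableSet_Ici) measurable_const
      measurable_const
  · rw [tendsto_pi_nhds]
    exact fun θ => (summable_reward hγ0 hγ1 hr hπ hs θ).hasSum.tendsto_sum_nat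

theorem integrable_rewardFrom {μ : Measure ℝ} [IsFiniteMeasure μ] (hγ0 : 0 ≤ γ) (hγ1 : γ < 1)
    (hr : IsReward r Lr rmax) (hπ : Admissible π) (hs : s.Valid) :
    Integrable (rewardFrom γ r π s) μ :=
  Integrable.of_mem_Icc 0 (rmax / (1 - γ)) (measurable_rewardFrom hγ0 hγ1 hr hπ hs).aemeasurable
    (ae_of_all _ fun θ => ⟨rewardFrom_nonneg hγ0 hr hπ hs θ, rewardFrom_le hγ0 hγ1 hr hπ hs θ⟩)

theorem admissible_deltaPolicy {δ : ℝ} {y : UIState → ℝ}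
    (hy : ∀ s : UIState, s.Valid → 0 ≤ s.budget → δ < s.up - s.lo → y s ∈ Icc s.lo s.up) :
    Admissible (deltaPolicy δ y) := by
  intro s hs hb
  unfold deltaPolicy
  split_ifs with h
  exacts [hy s hs hb h, hs.lo_mem]

end

/-! ### The threshold law -/

section Law

theorem condProb_mem {F : ℝ → ℝ} (hF : Monotone F) {s : UIState} {y : ℝ}
    (hy : y ∈ Icc s.lo s.up) : condProb F s y ∈ Icc (0 : ℝ) 1 := by
  have h1 := hF hy.1
  have h2 := hF hy.2
  exact ⟨div_nonneg (by linarith) (by linarith), div_le_one_of_le₀ (by linarith) (by linarith)⟩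

variable {μ : Measure ℝ} {Lc Lh : ℝ}

theorem IsThresholdLaw.ae_mem (hμ : IsThresholdLaw μ Lc Lh) : ∀ᵐ θ ∂μ, θ ∈ Ioo (0 : ℝ) 1 := by
  rw [ae_iff]; exact hμ.support

variable [IsProbabilityMeasure μ]

/-- In `(0,1)` the distribution function is Lipschitz, hence has no jumps; the complement is null.
-/
theorem IsThresholdLaw.measure_singleton (hμ : IsThresholdLaw μ Lc Lh) (x : ℝ) : μ {x} = 0 := by
  by_cases hx : x ∈ Ioo (0 : ℝ) 1
  swap
  · exact measure_mono_null (by simpa using hx) hμ.support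
  have hcont : ContinuousWithinAt (cdf μ) (Icc 0 1) x := by
    have hlip : LipschitzOnWith (Real.toNNReal Lh) (cdf μ) (Icc (0 : ℝ) 1) := by
      refine LipschitzOnWith.of_dist_le_mul fun a ha b hb => ?_
      wlog hab : a ≤ b generalizing a b
      · rw [dist_comm, dist_comm a]
        exact this b hb a ha (le_of_not_ge hab)
      rw [dist_comm, dist_comm a, Real.dist_eq, Real.dist_eq, abs_of_nonneg (sub_nonneg.2 hab),
        abs_of_nonneg (sub_nonneg.2 ((monotone_cdf μ) hab))]
      exact (hμ.upper a ha b hb hab).trans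
        (mul_le_mul_of_nonneg_right (Real.le_coe_toNNReal _) (sub_nonneg.2 hab))
    exact hlip.continuousOn x ⟨hx.1.le, hx.2.le⟩
  have hcont' : ContinuousAt (cdf μ) x := hcont.continuousAt (Icc_mem_nhds hx.1 hx.2)
  rw [← measure_cdf μ, StieltjesFunction.measure_singleton,
    hcont'.continuousWithinAt.leftLim_eq, sub_self, ENNReal.ofReal_zero]

/-- Half-open cells match the feedback rule: `y` is rejected exactly when `θ < y`, so `[ℓ, u)`
splits into `[ℓ, y)` and `[y, u)`. -/
theorem IsThresholdLaw.measureReal_Ico (hμ : IsThresholdLaw μ Lc Lh) {a b : ℝ} (hab : a ≤ b) :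
    μ.real (Ico a b) = cdf μ b - cdf μ a := by
  have : NullSingletonClass μ := ⟨hμ.measure_singleton⟩
  have h1 : μ.real (Ico a b) = μ.real (Ioc a b) := measureReal_congr Ico_ae_eq_Ioc
  rw [h1, ← Iic_sdiff_Iic, measureReal_sdiff (Iic_subset_Iic.2 hab) measurableSet_Iic,
    cdf_eq_real, cdf_eq_real]

/-- Multiplied by the probability of the uncertainty interval, the Bellman right-hand side needs
no division. -/
theorem measureReal_mul_bellmanQ (hLc : 0 < Lc) (hμ : IsThresholdLaw μ Lc Lh) (γ : ℝ) (r : ℝ → ℝ)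
    (V : UIState → ℝ) {s : UIState} (hs : s.Valid) (hlt : s.lo < s.up) {y : ℝ}
    (hy : y ∈ Icc s.lo s.up) :
    μ.real (Ico s.lo s.up) * bellmanQ γ r V s y (condProb (cdf μ) s y) =
      μ.real (Ico y s.up) * (r y + γ * V ⟨y, s.up, s.budget⟩) +
        μ.real (Ico s.lo y) * (γ * V ⟨s.lo, y, s.budget - 1⟩) := by
  have h0 : 0 < cdf μ s.up - cdf μ s.lo :=
    lt_of_lt_of_le (mul_pos hLc (sub_pos.2 hlt))
      (hμ.lower _ (hs.mem_unit hs.lo_mem) _ (hs.mem_unit ⟨hs.2.1, le_rfl⟩) hs.2.1)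
  rw [hμ.measureReal_Ico hs.2.1, hμ.measureReal_Ico hy.1, hμ.measureReal_Ico hy.2, bellmanQ,
    condProb]
  field_simp
  ring

end Law

/-! ### The reward collected in an uncertainty interval -/

/-- The reward from state `s`, integrated over the thresholds in its uncertainty interval. -/
noncomputable def cellReward (γ : ℝ) (r : ℝ → ℝ) (π : UIState → ℝ) (μ : Measure ℝ)
    (s : UIState) : ℝ :=
  ∫ θ in Ico s.lo s.up, rewardFrom γ r π s θ ∂μ

section Cell

variable {γ Lr rmax : ℝ} {r : ℝ → ℝ} {π : UIState → ℝ} {s : UIState} {μ : Measure ℝ}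

theorem cellReward_of_budget_neg (hb : s.budget < 0) : cellReward γ r π μ s = 0 := by
  simp [cellReward, rewardFrom_of_budget_neg hb]

theorem integral_policyReward_eq_cellReward {Lc Lh : ℝ} (hμ : IsThresholdLaw μ Lc Lh) (B : ℕ) :
    ∫ θ, policyReward γ r π B θ ∂μ = cellReward γ r π μ ⟨0, 1, B⟩ := by
  simp only [policyReward_eq_rewardFrom, cellReward]
  rw [Measure.restrict_eq_self_of_ae_mem]
  filter_upwards [hμ.ae_mem] with θ hθ using ⟨hθ.1.le, hθ.2⟩

variable [IsProbabilityMeasure μ]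

theorem abs_cellReward_le (hγ0 : 0 ≤ γ) (hγ1 : γ < 1) (hr : IsReward r Lr rmax)
    (hπ : Admissible π) (hs : s.Valid) :
    |cellReward γ r π μ s| ≤ rmax / (1 - γ) * μ.real (Ico s.lo s.up) := by
  rw [← Real.norm_eq_abs]
  refine norm_setIntegral_le_of_norm_le_const (measure_lt_top _ _) fun θ _ => ?_
  rw [Real.norm_eq_abs, abs_of_nonneg (rewardFrom_nonneg hγ0 hr hπ hs θ)]
  exact rewardFrom_le hγ0 hγ1 hr hπ hs θ

/-- All thresholds in `[ℓ, y)` reject `y` and lead to one common state, and all thresholds in `[y,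
u)` accept it. Integrating the one-step recursion over the two pieces gives the Bellman equation
with masses in place of conditional probabilities. -/
theorem cellReward_step (hγ0 : 0 ≤ γ) (hγ1 : γ < 1) (hr : IsReward r Lr rmax)
    (hπ : Admissible π) (hs : s.Valid) (hb : 0 ≤ s.budget) :
    cellReward γ r π μ s =
      μ.real (Ico (π s) s.up) * r (π s) + γ * cellReward γ r π μ ⟨π s, s.up, s.budget⟩ +
        γ * cellReward γ r π μ ⟨s.lo, π s, s.budget - 1⟩ := by
  have hy := hπ s hs hb
  have hi := integrable_rewardFrom (μ := μ) hγ0 hγ1 hr hπ hs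
  have hi1 := integrable_rewardFrom (μ := μ) hγ0 hγ1 hr hπ (hs.accept hy)
  rw [cellReward, ← Ico_union_Ico_eq_Ico hy.1 hy.2,
    setIntegral_union (Ico_disjoint_Ico_same) measurableSet_Ico hi.integrableOn hi.integrableOn]
  have h1 : ∫ θ in Ico s.lo (π s), rewardFrom γ r π s θ ∂μ =
      γ * cellReward γ r π μ ⟨s.lo, π s, s.budget - 1⟩ := by
    rw [cellReward, ← integral_const_mul]
    refine setIntegral_congr_fun measurableSet_Ico fun θ hθ => ?_
    have h : ¬ π s ≤ θ := not_le.2 hθ.2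
    rw [rewardFrom_step hγ0 hγ1 hr hπ hs]
    simp [UIState.next, h]
  have h2 : ∫ θ in Ico (π s) s.up, rewardFrom γ r π s θ ∂μ =
      μ.real (Ico (π s) s.up) * r (π s) +
        γ * cellReward γ r π μ ⟨π s, s.up, s.budget⟩ := by
    rw [cellReward, ← integral_const_mul, ← smul_eq_mul, ← setIntegral_const,
      ← integral_add (integrable_const _) (hi1.integrableOn.const_mul _)]
    refine setIntegral_congr_fun measurableSet_Ico fun θ hθ => ?_
    rw [rewardFrom_step hγ0 hγ1 hr hπ hs]
    simp [UIState.next, hθ.1, hb]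
  rw [h1, h2]
  ring

theorem cellReward_of_action_eq_lo (hγ0 : 0 ≤ γ) (hγ1 : γ < 1) (hr : IsReward r Lr rmax)
    (hπ : Admissible π) (hs : s.Valid) (hb : 0 ≤ s.budget) (hlo : π s = s.lo) :
    cellReward γ r π μ s = μ.real (Ico s.lo s.up) * (r s.lo / (1 - γ)) := by
  have h := cellReward_step (μ := μ) hγ0 hγ1 hr hπ hs hb
  have h0 : cellReward γ r π μ ⟨s.lo, s.lo, s.budget - 1⟩ = 0 := by simp [cellReward]
  rw [hlo, h0] at h
  have : (1 - γ) ≠ 0 := by linarith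
  field_simp
  -- Playing the lower end leaves the state unchanged, and the rejection cell `[ℓ, ℓ)` is empty: the
  -- recursion becomes a linear equation for a single number.
  change cellReward γ r π μ s = _ + γ * cellReward γ r π μ s + _ at h
  linarith

end Cell

/-! ### Planning with approximate probabilities -/

theorem le_of_forall_geometric {x A q C m : ℝ} (hq0 : 0 ≤ q) (hq1 : q < 1)
    (h : ∀ n : ℕ, x ≤ (A + q ^ n * C) * m) : x ≤ A * m := by
  have ht := ((((tendsto_pow_atTop_nhds_zero_of_lt_one hq0 hq1).mul_const C).const_add A).mul_const
    m)
  rw [zero_mul, add_zero] at ht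
  exact ge_of_tendsto' ht h

/-- A function of the state that vanishes on short intervals and after abandonment and loses at most
`A` per interaction loses at most `A / (1 - γ)` in total. -/
theorem le_of_discounted_step {γ δ A : ℝ} (hγ0 : 0 ≤ γ) (hγ1 : γ < 1) (hA : 0 ≤ A)
    {m : ℝ → ℝ → ℝ} (hm0 : ∀ a b, 0 ≤ m a b)
    (hm : ∀ a b c, a ≤ b → b ≤ c → m a c = m a b + m b c)
    {D : UIState → ℝ} {C : ℝ} (hC : 0 ≤ C) (hD : ∀ s : UIState, s.Valid → D s ≤ C * m s.lo s.up)
    (habandoned : ∀ s : UIState, s.Valid → s.budget < 0 → D s ≤ 0)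
    (hshort : ∀ s : UIState, s.Valid → 0 ≤ s.budget → s.up - s.lo ≤ δ → D s ≤ 0)
    (hstep : ∀ s : UIState, s.Valid → 0 ≤ s.budget → δ < s.up - s.lo → ∃ y ∈ Icc s.lo s.up,
      D s ≤ A * m s.lo s.up + γ * (D ⟨y, s.up, s.budget⟩ + D ⟨s.lo, y, s.budget - 1⟩))
    (s : UIState) (hs : s.Valid) : D s ≤ A / (1 - γ) * m s.lo s.up := by
  have h1γ : 0 < 1 - γ := sub_pos.2 hγ1
  -- Neither length nor budget need decrease, since `y = s.lo` repeats the state. The induction is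
  -- on the number of unrolled steps, and the a priori bound `C` is discounted away.
  refine le_of_forall_geometric hγ0 hγ1 (C := C) fun n => ?_
  induction n generalizing s with
  | zero =>
    refine (hD s hs).trans ?_
    gcongr
    · exact hm0 _ _
    · have : 0 ≤ A / (1 - γ) := by positivity
      linarith
  | succ n ih =>
    have hpos : 0 ≤ (A / (1 - γ) + γ ^ (n + 1) * C) * m s.lo s.up :=
      mul_nonneg (by positivity) (hm0 _ _)
    rcases lt_or_ge s.budget 0 with hb | hb
    · exact (habandoned s hs hb).trans hpos
    rcases le_or_gt (s.up - s.lo) δ with hδ | hδ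
    · exact (hshort s hs hb hδ).trans hpos
    obtain ⟨y, hy, h⟩ := hstep s hs hb hδ
    have ha := ih _ (hs.accept hy)
    have hr := ih _ (hs.reject hy)
    refine h.trans ?_
    have h2 := mul_le_mul_of_nonneg_left (add_le_add ha hr) hγ0
    -- Additivity of `m` recombines the two successor cells into the present one, so branching does
    -- not multiply the error.
    have h3 : A * m s.lo s.up + γ * ((A / (1 - γ) + γ ^ n * C) * m y s.up +
        (A / (1 - γ) + γ ^ n * C) * m s.lo y) = (A / (1 - γ) + γ ^ (n + 1) * C) * m s.lo s.up := by
      rw [hm s.lo y s.up hy.1 hy.2]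
      field_simp
      ring
    rw [← h3]
    linarith

/-! ### Bellman operators with signed weights close to probabilities -/

section Optimistic

variable {γ δ Lr rmax κ : ℝ} {r : ℝ → ℝ} {P : UIState → ℝ → ℝ} {V : UIState → ℝ}

/-- The total variation of the weights `p`, `1 - p` governs the Lipschitz constant of the Bellman
operator. It is `1` for a true probability, so the excess is only due to the estimation error. -/
theorem abs_add_abs_one_sub_le {p p₀ w : ℝ} (hp₀ : p₀ ∈ Icc (0 : ℝ) 1) (h : |p - p₀| ≤ w) :
    |p| + |1 - p| ≤ 1 + 2 * w := by
  have := abs_le.1 h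
  obtain ⟨h0, h1⟩ := hp₀
  rcases abs_cases p with h2 | h2 <;> rcases abs_cases (1 - p) with h3 | h3 <;> linarith

theorem abs_bellmanQ_sub_le {V W : UIState → ℝ} {s : UIState} {y p w d : ℝ} (hγ0 : 0 ≤ γ)
    (hd : 0 ≤ d) (hp : |p| + |1 - p| ≤ w)
    (ha : |V ⟨y, s.up, s.budget⟩ - W ⟨y, s.up, s.budget⟩| ≤ d)
    (hr : |V ⟨s.lo, y, s.budget - 1⟩ - W ⟨s.lo, y, s.budget - 1⟩| ≤ d) :
    |bellmanQ γ r V s y p - bellmanQ γ r W s y p| ≤ γ * w * d := by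
  have : bellmanQ γ r V s y p - bellmanQ γ r W s y p =
      p * (γ * (V ⟨y, s.up, s.budget⟩ - W ⟨y, s.up, s.budget⟩)) +
      (1 - p) * (γ * (V ⟨s.lo, y, s.budget - 1⟩ - W ⟨s.lo, y, s.budget - 1⟩)) := by
    unfold bellmanQ; ring
  rw [this]
  refine (abs_add_le _ _).trans ?_
  rw [abs_mul, abs_mul, abs_mul, abs_mul, abs_of_nonneg hγ0]
  calc |p| * (γ * _) + |1 - p| * (γ * _) ≤ |p| * (γ * d) + |1 - p| * (γ * d) := by gcongr
    _ = (|p| + |1 - p|) * (γ * d) := by ring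
    _ ≤ w * (γ * d) := by gcongr
    _ = γ * w * d := by ring

theorem abs_bellmanQ_le {s : UIState} {y p w d : ℝ} (hγ0 : 0 ≤ γ) (hd : 0 ≤ d)
    (hp : |p| + |1 - p| ≤ w) (hy : |r y| ≤ rmax) (ha : |V ⟨y, s.up, s.budget⟩| ≤ d)
    (hr : |V ⟨s.lo, y, s.budget - 1⟩| ≤ d) :
    |bellmanQ γ r V s y p| ≤ w * rmax + γ * w * d := by
  have h := abs_bellmanQ_sub_le (r := r) (V := V) (W := fun _ => 0) (s := s) (y := y) hγ0 hd hp
    (by simpa using ha) (by simpa using hr)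
  have h0 : bellmanQ γ r (fun _ => 0) s y p = p * r y := by simp [bellmanQ]
  have h1 : |p * r y| ≤ w * rmax := by
    rw [abs_mul]
    exact mul_le_mul (by linarith [abs_nonneg (1 - p)]) hy (abs_nonneg _)
      (by linarith [abs_nonneg (1 - p), abs_nonneg p])
  rw [h0] at h
  have := abs_sub_abs_le_abs_sub (bellmanQ γ r V s y p) (p * r y)
  linarith

theorem abs_bellmanQ_sub_prob_le {s : UIState} {y p p₀ d : ℝ} (hγ0 : 0 ≤ γ) (hγ1 : γ < 1)
    (hp : |p - p₀| ≤ κ) (hy : |r y| ≤ rmax) (ha : |V ⟨y, s.up, s.budget⟩| ≤ d)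
    (hr : |V ⟨s.lo, y, s.budget - 1⟩| ≤ d) :
    |bellmanQ γ r V s y p - bellmanQ γ r V s y p₀| ≤ κ * (rmax + 2 * d) := by
  have : bellmanQ γ r V s y p - bellmanQ γ r V s y p₀ = (p - p₀) *
      (r y + γ * (V ⟨y, s.up, s.budget⟩ - V ⟨s.lo, y, s.budget - 1⟩)) := by
    unfold bellmanQ; ring
  rw [this, abs_mul]
  refine mul_le_mul hp ?_ (abs_nonneg _) ((abs_nonneg _).trans hp)
  refine (abs_add_le _ _).trans (add_le_add hy ?_)
  rw [abs_mul, abs_of_nonneg hγ0]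
  have h1 := (abs_sub _ _ : |V ⟨y, s.up, s.budget⟩ - V ⟨s.lo, y, s.budget - 1⟩| ≤ _)
  calc γ * |V ⟨y, s.up, s.budget⟩ - V ⟨s.lo, y, s.budget - 1⟩|
      ≤ 1 * |V ⟨y, s.up, s.budget⟩ - V ⟨s.lo, y, s.budget - 1⟩| := by gcongr
    _ ≤ 2 * d := by linarith

theorem IsReward.abs_apply_le (hr : IsReward r Lr rmax) {y : ℝ} (hy : y ∈ Icc (0 : ℝ) 1) :
    |r y| ≤ rmax := by
  rw [abs_of_nonneg (hr.nonneg y hy)]; exact hr.le_max y hy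

theorem IsReward.abs_div_le (hγ1 : γ < 1) (hr : IsReward r Lr rmax) {y : ℝ}
    (hy : y ∈ Icc (0 : ℝ) 1) : |r y / (1 - γ)| ≤ rmax / (1 - γ) := by
  have h : 0 < 1 - γ := sub_pos.2 hγ1
  rw [abs_div, abs_of_pos h]
  exact div_le_div_of_nonneg_right (hr.abs_apply_le hy) h.le

/-- If the probabilities are accurate, optimistic values are bounded. -/
theorem IsOptimisticValue.abs_apply_le (hγ0 : 0 ≤ γ) (hγ1 : γ < 1) (hr : IsReward r Lr rmax)
    (hP : ∀ s : UIState, s.Valid → δ < s.up - s.lo → ∀ y ∈ Icc s.lo s.up,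
      |P s y| + |1 - P s y| ≤ 1 + (1 - γ) / 2)
    (hV : IsOptimisticValue γ δ r P V) (s : UIState) (hs : s.Valid) :
    |V s| ≤ 4 * rmax / (1 - γ) := by
  have hr0 := hr.rmax_nonneg
  have h1γ : 0 < 1 - γ := sub_pos.2 hγ1
  obtain ⟨C, hC⟩ := hV.bounded
  have hC0 : 0 ≤ C := (abs_nonneg _).trans (hC s hs)
  have key : |V s| ≤ 4 * rmax / (1 - γ) * 1 := by
    -- Since `γ (1 + (1 - γ) / 2) ≤ (1 + γ) / 2`, a bound `d` improves to `2 rmax + (1 + γ) / 2 *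
    -- d`, whose fixed point is `4 rmax / (1 - γ)`.
    refine le_of_forall_geometric (q := (1 + γ) / 2) (C := C) (by linarith) (by linarith)
      fun n => ?_
    rw [mul_one]
    induction n generalizing s with
    | zero =>
      have : 0 ≤ 4 * rmax / (1 - γ) := by positivity
      linarith [hC s hs]
    | succ n ih =>
      have hq : 0 ≤ ((1 + γ) / 2) ^ n * C := by positivity
      have hpos : rmax / (1 - γ) ≤ 4 * rmax / (1 - γ) + ((1 + γ) / 2) ^ (n + 1) * C := by
        have : rmax / (1 - γ) ≤ 4 * rmax / (1 - γ) := by gcongr; linarith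
        have : 0 ≤ ((1 + γ) / 2) ^ (n + 1) * C := by positivity
        linarith
      have hpos' : 0 ≤ rmax / (1 - γ) := by positivity
      rcases lt_or_ge s.budget 0 with hb | hb
      · rw [hV.abandoned s hs hb, abs_zero]; linarith
      rcases le_or_gt (s.up - s.lo) δ with hδ | hδ
      · rw [hV.conservative s hs hb hδ]
        exact (hr.abs_div_le hγ1 (hs.mem_unit hs.lo_mem)).trans hpos
      have hlub := hV.bellman s hs hb hδ
      set d := 4 * rmax / (1 - γ) + ((1 + γ) / 2) ^ n * C with hd
      have hd0 : 0 ≤ d := by positivity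
      have hall : ∀ y ∈ Icc s.lo s.up, |bellmanQ γ r V s y (P s y)| ≤
          4 * rmax / (1 - γ) + ((1 + γ) / 2) ^ (n + 1) * C := by
        intro y hy
        refine (abs_bellmanQ_le hγ0 hd0 (hP s hs hδ y hy) (hr.abs_apply_le (hs.mem_unit hy))
          (ih _ (hs.accept hy)) (ih _ (hs.reject hy))).trans ?_
        have e1 : (1 + (1 - γ) / 2) * rmax ≤ 2 * rmax := by gcongr; linarith
        have e2 : γ * (1 + (1 - γ) / 2) * d ≤ (1 + γ) / 2 * d := by
          gcongr; nlinarith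
        have e3 : 2 * rmax + (1 + γ) / 2 * d =
            4 * rmax / (1 - γ) + ((1 + γ) / 2) ^ (n + 1) * C := by
          rw [hd]; field_simp; ring
        linarith
      rw [abs_le]
      constructor
      · have := hlub.1 (mem_image_of_mem _ hs.lo_mem)
        exact (abs_le.1 (hall _ hs.lo_mem)).1.trans this
      · refine hlub.2 ?_
        rintro _ ⟨y, hy, rfl⟩
        exact (abs_le.1 (hall y hy)).2
  simpa using key

/-- If the probabilities are accurate, the optimistic Bellman operator is a contraction. -/
theorem exists_isOptimisticValue (hγ0 : 0 ≤ γ) (hγ1 : γ < 1) (hr : IsReward r Lr rmax)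
    (hP : ∀ s : UIState, s.Valid → δ < s.up - s.lo → ∀ y ∈ Icc s.lo s.up,
      |P s y| + |1 - P s y| ≤ 1 + (1 - γ) / 2) :
    ∃ V, IsOptimisticValue γ δ r P V := by
  classical
  -- With the discrete topology every bounded function of the state is continuous, so Banach's
  -- theorem applies in the complete space of bounded continuous functions.
  let : TopologicalSpace UIState := ⊥
  have : DiscreteTopology UIState := ⟨rfl⟩
  have hr0 := hr.rmax_nonneg
  have h1γ : 0 < 1 - γ := sub_pos.2 hγ1
  let T : (UIState → ℝ) → UIState → ℝ := fun V s =>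
    if s.Valid ∧ 0 ≤ s.budget then
      if s.up - s.lo ≤ δ then r s.lo / (1 - γ)
      else sSup ((fun y => bellmanQ γ r V s y (P s y)) '' Icc s.lo s.up)
    else 0
  have hQ : ∀ (V : UIState → ℝ) (d : ℝ), 0 ≤ d → (∀ s, |V s| ≤ d) → ∀ s : UIState, s.Valid →
      δ < s.up - s.lo → ∀ y ∈ Icc s.lo s.up, |bellmanQ γ r V s y (P s y)| ≤ 2 * rmax + d := by
    intro V d hd hV s hs hδ y hy
    refine (abs_bellmanQ_le hγ0 hd (hP s hs hδ y hy) (hr.abs_apply_le (hs.mem_unit hy)) (hV _)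
      (hV _)).trans ?_
    have e1 : (1 + (1 - γ) / 2) * rmax ≤ 2 * rmax := by gcongr; linarith
    have e2 : γ * (1 + (1 - γ) / 2) * d ≤ 1 * d := by gcongr; nlinarith
    linarith
  have hlub : ∀ (V : UIState → ℝ) (d : ℝ), 0 ≤ d → (∀ s, |V s| ≤ d) → ∀ s : UIState, s.Valid →
      δ < s.up - s.lo → IsLUB ((fun y => bellmanQ γ r V s y (P s y)) '' Icc s.lo s.up)
        (sSup ((fun y => bellmanQ γ r V s y (P s y)) '' Icc s.lo s.up)) := by
    intro V d hd hV s hs hδ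
    refine isLUB_csSup ⟨_, mem_image_of_mem _ hs.lo_mem⟩ ⟨2 * rmax + d, ?_⟩
    rintro _ ⟨y, hy, rfl⟩
    exact (abs_le.1 (hQ V d hd hV s hs hδ y hy)).2
  have hTb : ∀ (V : UIState → ℝ) (d : ℝ), 0 ≤ d → (∀ s, |V s| ≤ d) → ∀ s,
      ‖T V s‖ ≤ 2 * rmax + d + rmax / (1 - γ) := by
    intro V d hd hV s
    have hpos' : 0 ≤ rmax / (1 - γ) := by positivity
    rw [Real.norm_eq_abs]
    simp only [T]
    split_ifs with h1 h2
    · have := hr.abs_div_le hγ1 (h1.1.mem_unit h1.1.lo_mem)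
      linarith
    · rw [not_le] at h2
      have hl := hlub V d hd hV s h1.1 h2
      rw [abs_le]
      constructor
      · have h3 := hl.1 (mem_image_of_mem _ h1.1.lo_mem)
        have h4 := (abs_le.1 (hQ V d hd hV s h1.1 h2 _ h1.1.lo_mem)).1
        linarith
      · refine hl.2 ?_
        rintro _ ⟨y, hy, rfl⟩
        have h4 := (abs_le.1 (hQ V d hd hV s h1.1 h2 _ hy)).2
        linarith
    · rw [abs_zero]; linarith
  let T' : BoundedContinuousFunction UIState ℝ → BoundedContinuousFunction UIState ℝ := fun V =>
    BoundedContinuousFunction.ofNormedAddCommGroupDiscrete (T V)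
      (2 * rmax + ‖V‖ + rmax / (1 - γ)) (hTb V ‖V‖ (norm_nonneg _) V.norm_coe_le_norm)
  have hle : ∀ V W : BoundedContinuousFunction UIState ℝ, ∀ s,
      T V s ≤ T W s + (1 + γ) / 2 * dist V W := by
    intro V W s
    have hd : 0 ≤ (1 + γ) / 2 * dist V W := by positivity
    simp only [T]
    split_ifs with h1 h2
    · linarith
    · rw [not_le] at h2
      refine (hlub V ‖V‖ (norm_nonneg _) V.norm_coe_le_norm s h1.1 h2).2 ?_
      rintro _ ⟨y, hy, rfl⟩
      have h3 := (hlub W ‖W‖ (norm_nonneg _) W.norm_coe_le_norm s h1.1 h2).1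
        (mem_image_of_mem _ hy)
      have h4 := abs_bellmanQ_sub_le (r := r) (V := V) (W := W) (s := s) (y := y) hγ0
        (dist_nonneg : 0 ≤ dist V W) (hP s h1.1 h2 y hy)
        (by rw [← Real.dist_eq]; exact BoundedContinuousFunction.dist_coe_le_dist _)
        (by rw [← Real.dist_eq]; exact BoundedContinuousFunction.dist_coe_le_dist _)
      have e2 : γ * (1 + (1 - γ) / 2) * dist V W ≤ (1 + γ) / 2 * dist V W := by
        gcongr; nlinarith
      have := (abs_le.1 h4).2
      dsimp only at h3 ⊢
      linarith
    · linarith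
  have hcontr : ContractingWith (Real.toNNReal ((1 + γ) / 2)) T' := by
    refine ⟨by rw [← NNReal.coe_lt_coe, Real.coe_toNNReal _ (by linarith)]; simp; linarith,
      LipschitzWith.of_dist_le_mul fun V W => ?_⟩
    rw [Real.coe_toNNReal _ (by linarith)]
    refine (BoundedContinuousFunction.dist_le (by positivity)).2 fun s => ?_
    rw [Real.dist_eq, abs_le]
    have h1 := hle V W s
    have h2 := hle W V s
    rw [dist_comm W V] at h2
    constructor <;> (simp only [T', BoundedContinuousFunction.coe_ofNormedAddCommGroupDiscrete]; linarith)
  let V := ContractingWith.fixedPoint T' hcontr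
  have hfix : ∀ s, T V s = V s := fun s => by
    have h : T' V = V := hcontr.fixedPoint_isFixedPt
    exact congrArg (fun W : BoundedContinuousFunction UIState ℝ => W s) h
  refine ⟨V, ⟨‖V‖, fun s _ => V.norm_coe_le_norm s⟩, fun s _ hb => ?_, fun s hs hb hδ => ?_,
    fun s hs hb hδ => ?_⟩
  · rw [← hfix]; simp [T, hb.not_ge]
  · rw [← hfix]
    simp only [T, if_pos hδ, if_pos (And.intro hs hb)]
  · rw [← hfix s]
    simp only [T, if_neg hδ.not_ge, if_pos (And.intro hs hb)]
    exact hlub V ‖V‖ (norm_nonneg _) V.norm_coe_le_norm s hs hδ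

end Optimistic

/-! ### Value loss per user and decomposition of the regret -/

section Comparison

variable {γ δ τ κ Lr Lc Lh rmax : ℝ} {r : ℝ → ℝ} {P : UIState → ℝ → ℝ} {V : UIState → ℝ}
  {μ : Measure ℝ} [IsProbabilityMeasure μ]

theorem measureReal_Ico_add {a b c : ℝ} (hab : a ≤ b) (hbc : b ≤ c) :
    μ.real (Ico a c) = μ.real (Ico a b) + μ.real (Ico b c) := by
  rw [← Ico_union_Ico_eq_Ico hab hbc, measureReal_union Ico_disjoint_Ico_same measurableSet_Ico]

/-- The reward of a `δ`-policy that plays up to `τ` a greedy action for the optimistic value is at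
least the optimistic value, up to the error in the probabilities; the reward of any `δ`-policy is
at most this. -/
theorem deltaValue_sub_le (hγ0 : 0 ≤ γ) (hγ1 : γ < 1) (hδ : 0 < δ) (hr : IsReward r Lr rmax)
    (hLc : 0 < Lc) (hμ : IsThresholdLaw μ Lc Lh) (hκ0 : 0 ≤ κ) (hκ : κ ≤ (1 - γ) / 4)
    (hP : ∀ s : UIState, s.Valid → δ < s.up - s.lo → ∀ y ∈ Icc s.lo s.up,
      |P s y - condProb (cdf μ) s y| ≤ κ)
    (hτ : 0 ≤ τ) {yhat ystar : UIState → ℝ} (hyhat : IsPlannedAction γ δ τ r P yhat)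
    (hystar : ∀ s : UIState, s.Valid → 0 ≤ s.budget → δ < s.up - s.lo → ystar s ∈ Icc s.lo s.up)
    (B : ℕ) :
    deltaValue γ δ r μ ystar B - deltaValue γ δ r μ yhat B ≤
      (τ + 2 * (κ * (rmax + 2 * (4 * rmax / (1 - γ))))) / (1 - γ) := by
  have h1γ : 0 < 1 - γ := sub_pos.2 hγ1
  have hr0 := hr.rmax_nonneg
  have hPw : ∀ s : UIState, s.Valid → δ < s.up - s.lo → ∀ y ∈ Icc s.lo s.up,
      |P s y| + |1 - P s y| ≤ 1 + (1 - γ) / 2 := fun s hs hl y hy => by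
    have := abs_add_abs_one_sub_le (condProb_mem (monotone_cdf μ) hy) (hP s hs hl y hy)
    linarith
  obtain ⟨hyI, hex⟩ := hyhat
  obtain ⟨V, hV, hgreedy⟩ := hex (exists_isOptimisticValue hγ0 hγ1 hr hPw)
  have hVb := hV.abs_apply_le hγ0 hγ1 hr hPw
  set E := κ * (rmax + 2 * (4 * rmax / (1 - γ))) with hE
  have hE0 : 0 ≤ E := by positivity
  have hQ : ∀ s : UIState, s.Valid → δ < s.up - s.lo → ∀ y ∈ Icc s.lo s.up,
      |bellmanQ γ r V s y (P s y) - bellmanQ γ r V s y (condProb (cdf μ) s y)| ≤ E :=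
    fun s hs hl y hy => abs_bellmanQ_sub_prob_le hγ0 hγ1 (hP s hs hl y hy)
      (hr.abs_apply_le (hs.mem_unit hy)) (hVb _ (hs.accept hy)) (hVb _ (hs.reject hy))
  let m : ℝ → ℝ → ℝ := fun a b => μ.real (Ico a b)
  have hm0 : ∀ a b, 0 ≤ m a b := fun a b => measureReal_nonneg
  have hm : ∀ a b c, a ≤ b → b ≤ c → m a c = m a b + m b c := fun a b c => measureReal_Ico_add
  have hdiff : ∀ π, Admissible π → ∀ s : UIState, s.Valid →
      |cellReward γ r π μ s - m s.lo s.up * V s| ≤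
        (rmax / (1 - γ) + 4 * rmax / (1 - γ)) * m s.lo s.up := fun π hπ s hs => by
    refine (abs_sub _ _).trans ?_
    rw [abs_mul, abs_of_nonneg (hm0 _ _), add_mul, mul_comm (m s.lo s.up)]
    exact add_le_add (abs_cellReward_le hγ0 hγ1 hr hπ hs)
      (mul_le_mul_of_nonneg_right (hVb s hs) (hm0 _ _))
  have hC : 0 ≤ rmax / (1 - γ) + 4 * rmax / (1 - γ) := by positivity
  have hneg : ∀ π, ∀ s : UIState, s.Valid → s.budget < 0 →
      cellReward γ r π μ s = m s.lo s.up * V s := fun π s hs hb => by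
    rw [cellReward_of_budget_neg hb, hV.abandoned s hs hb, mul_zero]
  have hshort : ∀ y, Admissible (deltaPolicy δ y) → ∀ s : UIState, s.Valid → 0 ≤ s.budget →
      s.up - s.lo ≤ δ → cellReward γ r (deltaPolicy δ y) μ s = m s.lo s.up * V s :=
    fun y hy s hs hb hl => by
      rw [hV.conservative s hs hb hl, cellReward_of_action_eq_lo hγ0 hγ1 hr hy hs hb]
      simp [deltaPolicy, hl.not_gt]
  have hstar := admissible_deltaPolicy hystar
  have hhat := admissible_deltaPolicy hyI
  have hs0 : UIState.Valid ⟨0, 1, B⟩ := ⟨le_rfl, zero_le_one, le_rfl⟩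
  have hm1 : m 0 1 ≤ 1 := measureReal_le_one
  -- `V` dominates the optimistic right-hand side at every action; replacing `P` by the true
  -- probability costs `E`.
  have upper := le_of_discounted_step (δ := δ) hγ0 hγ1 hE0 hm0 hm
    (D := fun s => cellReward γ r (deltaPolicy δ ystar) μ s - m s.lo s.up * V s) hC
    (fun s hs => (le_abs_self _).trans (hdiff _ hstar s hs))
    (fun s hs hb => (sub_eq_zero.2 (hneg _ s hs hb)).le)
    (fun s hs hb hl => (sub_eq_zero.2 (hshort _ hstar s hs hb hl)).le)
    (fun s hs hb hl => by
      have hy := hystar s hs hb hl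
      have hpol : deltaPolicy δ ystar s = ystar s := if_pos hl
      refine ⟨ystar s, hy, ?_⟩
      have h1 := (hV.bellman s hs hb hl).1 (mem_image_of_mem _ hy)
      have h2 := (abs_le.1 (hQ s hs hl _ hy)).1
      have h3 := measureReal_mul_bellmanQ hLc hμ γ r V hs (by linarith) hy
      have h4 := cellReward_step (μ := μ) hγ0 hγ1 hr hstar hs hb
      rw [hpol] at h4
      dsimp only at h1 ⊢
      have h5 : m s.lo s.up * bellmanQ γ r V s (ystar s) (condProb (cdf μ) s (ystar s)) ≤
          m s.lo s.up * (V s + E) := mul_le_mul_of_nonneg_left (by linarith) (hm0 _ _)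
      simp only [m] at h5 ⊢
      linarith) ⟨0, 1, B⟩ hs0
  -- Here the planned action attains `V` up to `τ`, so the loss per interaction is `τ + E`.
  have lower := le_of_discounted_step (δ := δ) hγ0 hγ1 (add_nonneg hτ hE0) hm0 hm
    (D := fun s => m s.lo s.up * V s - cellReward γ r (deltaPolicy δ yhat) μ s) hC
    (fun s hs => (le_abs_self _).trans (by rw [abs_sub_comm]; exact hdiff _ hhat s hs))
    (fun s hs hb => (sub_eq_zero.2 (hneg _ s hs hb).symm).le)
    (fun s hs hb hl => (sub_eq_zero.2 (hshort _ hhat s hs hb hl).symm).le)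
    (fun s hs hb hl => by
      have hy := hyI s hs hb hl
      have hpol : deltaPolicy δ yhat s = yhat s := if_pos hl
      refine ⟨yhat s, hy, ?_⟩
      have h1 := hgreedy s hs hb hl
      have h2 := (abs_le.1 (hQ s hs hl _ hy)).2
      have h3 := measureReal_mul_bellmanQ hLc hμ γ r V hs (by linarith) hy
      have h4 := cellReward_step (μ := μ) hγ0 hγ1 hr hhat hs hb
      rw [hpol] at h4
      dsimp only
      have h5 : m s.lo s.up * (V s - τ - E) ≤
          m s.lo s.up * bellmanQ γ r V s (yhat s) (condProb (cdf μ) s (yhat s)) :=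
        mul_le_mul_of_nonneg_left (by linarith) (hm0 _ _)
      simp only [m] at h5 ⊢
      linarith) ⟨0, 1, B⟩ hs0
  rw [deltaValue, deltaValue, integral_policyReward_eq_cellReward hμ,
    integral_policyReward_eq_cellReward hμ]
  have h6 : E / (1 - γ) * m 0 1 ≤ E / (1 - γ) := mul_le_of_le_one_right (by positivity) hm1
  have h7 : (τ + E) / (1 - γ) * m 0 1 ≤ (τ + E) / (1 - γ) :=
    mul_le_of_le_one_right (by positivity) hm1
  have h8 : (τ + 2 * E) / (1 - γ) = E / (1 - γ) + (τ + E) / (1 - γ) := by ring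
  dsimp only at upper lower
  linarith

theorem policyReward_mem (hγ0 : 0 ≤ γ) (hγ1 : γ < 1) (hr : IsReward r Lr rmax)
    {π : UIState → ℝ} (hπ : Admissible π) (B : ℕ) (θ : ℝ) :
    policyReward γ r π B θ ∈ Icc 0 (rmax / (1 - γ)) := by
  have hs0 : UIState.Valid ⟨0, 1, B⟩ := ⟨le_rfl, zero_le_one, le_rfl⟩
  rw [policyReward_eq_rewardFrom]
  exact ⟨rewardFrom_nonneg hγ0 hr hπ hs0 θ, rewardFrom_le hγ0 hγ1 hr hπ hs0 θ⟩

theorem integrable_policyReward (hγ0 : 0 ≤ γ) (hγ1 : γ < 1) (hr : IsReward r Lr rmax)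
    {π : UIState → ℝ} (hπ : Admissible π) (B : ℕ) : Integrable (policyReward γ r π B) μ := by
  have hs0 : UIState.Valid ⟨0, 1, B⟩ := ⟨le_rfl, zero_le_one, le_rfl⟩
  refine (integrable_rewardFrom (μ := μ) hγ0 hγ1 hr hπ hs0).congr (ae_of_all _ fun θ => ?_)
  exact (policyReward_eq_rewardFrom ..).symm

theorem integral_sum_policyReward (hγ0 : 0 ≤ γ) (hγ1 : γ < 1) (hr : IsReward r Lr rmax)
    {y : UIState → ℝ} (hy : Admissible (deltaPolicy δ y)) (B m : ℕ) (W : ℝ) :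
    ∫ θ : Fin m → ℝ, (W + ∑ n, policyReward γ r (deltaPolicy δ y) B (θ n))
      ∂(Measure.pi fun _ => μ) = W + m * deltaValue γ δ r μ y B := by
  have hi := integrable_policyReward (μ := μ) hγ0 hγ1 hr hy B
  have hi' : ∀ n : Fin m, Integrable (fun θ : Fin m → ℝ =>
      policyReward γ r (deltaPolicy δ y) B (θ n)) (Measure.pi fun _ => μ) := fun n =>
    (measurePreserving_eval (fun _ : Fin m => μ) n).integrable_comp_of_integrable hi
  rw [integral_add (integrable_const _) (integrable_finsetSum _ fun n _ => hi' n),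
    integral_finsetSum _ fun n _ => hi' n]
  have h : ∀ n : Fin m, ∫ θ : Fin m → ℝ, policyReward γ r (deltaPolicy δ y) B (θ n)
      ∂(Measure.pi fun _ => μ) = deltaValue γ δ r μ y B := fun n =>
    integral_comp_eval (μ := fun _ : Fin m => μ) (i := n) hi.aestronglyMeasurable
  simp [h]

theorem deltaValue_mem (hγ0 : 0 ≤ γ) (hγ1 : γ < 1) (hr : IsReward r Lr rmax)
    {y : UIState → ℝ} (hy : Admissible (deltaPolicy δ y)) (B : ℕ) :
    deltaValue γ δ r μ y B ∈ Icc 0 (rmax / (1 - γ)) := by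
  have hb := policyReward_mem hγ0 hγ1 hr hy B
  refine ⟨integral_nonneg fun θ => (hb θ).1, ?_⟩
  have := integral_mono (integrable_policyReward (μ := μ) hγ0 hγ1 hr hy B)
    (integrable_const (rmax / (1 - γ))) fun θ => (hb θ).2
  simpa [deltaValue] using this

/-- The regret is at most the value of the explored users plus the per-user loss on the others. -/
theorem deltaRegret_le (hγ0 : 0 ≤ γ) (hγ1 : γ < 1) (hr : IsReward r Lr rmax)
    {ystar yhat : UIState → ℝ} (hystar : Admissible (deltaPolicy δ ystar))
    (hyhat : Admissible (deltaPolicy δ yhat)) {N L B : ℕ} (hLN : L ≤ N) {W c : ℝ} (hW : 0 ≤ W)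
    (hc0 : 0 ≤ c) (hc : deltaValue γ δ r μ ystar B - deltaValue γ δ r μ yhat B ≤ c) :
    deltaRegret γ δ r μ ystar N L B W (deltaPolicy δ yhat) ≤ L * (rmax / (1 - γ)) + N * c := by
  rw [deltaRegret, integral_sum_policyReward hγ0 hγ1 hr hyhat, Nat.cast_sub hLN]
  have h1 := (deltaValue_mem (μ := μ) hγ0 hγ1 hr hystar B).2
  have hL : (0 : ℝ) ≤ L := L.cast_nonneg
  have hNL : (0 : ℝ) ≤ (N : ℝ) - L := sub_nonneg.2 (Nat.cast_le.2 hLN)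
  have h2 := mul_le_mul_of_nonneg_left h1 hL
  have h3 := mul_le_mul_of_nonneg_left hc hNL
  have h4 : 0 ≤ (L : ℝ) * c := by positivity
  linarith

end Comparison

/-! ### The linear search -/

/-- Consistency of a search state: in a round on `[base, top]` the `k` first grid points were
accepted. -/
structure SearchState.WellFormed (φ : ℕ) (s : SearchState) : Prop where
  base_nonneg : 0 ≤ s.base
  base_le_top : s.base ≤ s.top
  top_le_one : s.top ≤ 1
  up_eq : s.up = s.top
  k_le : s.k ≤ φ
  -- Truncated subtraction is intended: `lo = base` both for `k = 0` and for `k = 1`, as the first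
  -- grid point is `base` itself.
  lo_eq : s.lo = s.base + ((s.k - 1 : ℕ) : ℝ) * ((s.top - s.base) / φ)

section Search

variable {φ : ℕ} {β θ : ℝ} {s : SearchState}

theorem SearchState.WellFormed.step_nonneg (h : s.WellFormed φ) :
    0 ≤ (s.top - s.base) / φ :=
  div_nonneg (sub_nonneg.2 h.base_le_top) φ.cast_nonneg

theorem SearchState.WellFormed.mul_step_le (hφ : 2 ≤ φ) (h : s.WellFormed φ) {k : ℕ}
    (hk : k ≤ φ) : s.base + k * ((s.top - s.base) / φ) ≤ s.top := by
  have hφ0 : (φ : ℝ) ≠ 0 := by positivity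
  have h1 : (k : ℝ) * ((s.top - s.base) / φ) ≤ φ * ((s.top - s.base) / φ) :=
    mul_le_mul_of_nonneg_right (Nat.cast_le.2 hk) h.step_nonneg
  rw [mul_div_cancel₀ _ hφ0] at h1
  linarith

theorem SearchState.WellFormed.base_le_lo (h : s.WellFormed φ) : s.base ≤ s.lo := by
  rw [h.lo_eq]
  exact le_add_of_nonneg_right (mul_nonneg (Nat.cast_nonneg _) h.step_nonneg)

theorem SearchState.WellFormed.lo_le_up (hφ : 2 ≤ φ) (h : s.WellFormed φ) : s.lo ≤ s.up := by
  rw [h.lo_eq, h.up_eq]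
  exact h.mul_step_le hφ ((Nat.sub_le _ _).trans h.k_le)

theorem SearchState.WellFormed.action_mem (hφ : 2 ≤ φ) (h : s.WellFormed φ) :
    s.action φ β ∈ Icc s.lo s.up := by
  unfold SearchState.action
  split_ifs
  · exact ⟨le_rfl, h.lo_le_up hφ⟩
  · refine ⟨?_, by rw [h.up_eq]; exact h.mul_step_le hφ h.k_le⟩
    rw [h.lo_eq]
    gcongr
    · exact h.step_nonneg
    · exact Nat.sub_le _ _

theorem SearchState.WellFormed.next (hφ : 2 ≤ φ) (h : s.WellFormed φ) :
    (s.next φ β θ).WellFormed φ := by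
  have ha := h.action_mem (β := β) hφ
  have hlo := h.base_nonneg.trans h.base_le_lo
  have hup : s.up ≤ 1 := h.up_eq.le.trans h.top_le_one
  unfold SearchState.next
  split_ifs with h1 h2 h3 h4
  · exact ⟨h.base_nonneg, h.base_le_top, h.top_le_one, h.up_eq, h.k_le, h.lo_eq⟩
  · exact ⟨h.base_nonneg, h.base_le_top, h.top_le_one, h.up_eq, h.k_le, h.lo_eq⟩
  · exact ⟨hlo.trans ha.1, ha.2, hup, rfl, Nat.zero_le _, by simp⟩
  · refine ⟨h.base_nonneg, h.base_le_top, h.top_le_one, h.up_eq, ?_, ?_⟩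
    · exact Nat.succ_le_of_lt (lt_of_le_of_ne h.k_le h4)
    · simp [SearchState.action, h1]
  · exact ⟨hlo, ha.1, ha.2.trans hup, rfl, Nat.zero_le _, by simp⟩

theorem wellFormed_searchState (hφ : 2 ≤ φ) (B : ℕ) (θ : ℝ) (t : ℕ) :
    (searchState φ β B θ t).WellFormed φ := by
  induction t with
  | zero => exact ⟨le_rfl, zero_le_one, le_rfl, rfl, Nat.zero_le _, by simp [searchState]⟩
  | succ t ih => exact ih.next hφ

theorem searchReward_nonneg {γ Lr rmax : ℝ} {r : ℝ → ℝ} (hγ0 : 0 ≤ γ) (hr : IsReward r Lr rmax)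
    (hφ : 2 ≤ φ) (B : ℕ) (θ : ℝ) : 0 ≤ searchReward γ r φ β B θ := by
  refine tsum_nonneg fun t => ?_
  have h := wellFormed_searchState (β := β) hφ B θ t
  have ha := h.action_mem (β := β) hφ
  have := hr.nonneg _ ⟨(h.base_nonneg.trans h.base_le_lo).trans ha.1,
    ha.2.trans (h.up_eq.le.trans h.top_le_one)⟩
  dsimp only
  split_ifs
  · positivity
  · exact le_rfl

/-- After `j` negative answers the round is on an interval of length `φ⁻ʲ` that contains the
threshold. -/
structure SearchState.AtLevel (φ : ℕ) (β : ℝ) (B : ℕ) (θ : ℝ) (j : ℕ) (s : SearchState) :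
    Prop where
  budget_eq : s.budget = B - j
  length_eq : s.top - s.base = ((φ : ℝ) ^ j)⁻¹
  started : 0 < s.k → β < s.top - s.base
  previous : j = 0 ∨ β < φ * (s.top - s.base)
  lo_le : s.lo ≤ θ
  lt_up : θ < s.up

/-- A round has at most `φ + 1` actions and, for a threshold inside its interval, can only end with
a rejection. Hence, as long as the search has not rested, time is bounded by the number of
rejections; this forces termination. -/
theorem exists_atLevel (hφ : 2 ≤ φ) (hθ : θ ∈ Ioo (0 : ℝ) 1) (B t : ℕ) :
    ∃ j, (searchState φ β B θ t).AtLevel φ β B θ j ∧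
      ((∀ i < t, ¬ (searchState φ β B θ i).Resting β) →
        t ≤ (φ + 1) * j + (searchState φ β B θ t).k) := by
  induction t with
  | zero =>
    exact ⟨0, ⟨by simp [searchState], by simp [searchState], by simp [searchState], Or.inl rfl,
      hθ.1.le, hθ.2⟩, fun _ => Nat.zero_le _⟩
  | succ t ih =>
    obtain ⟨j, h, hcount⟩ := ih
    have hw := wellFormed_searchState (β := β) hφ B θ t
    have hφ0 : (φ : ℝ) ≠ 0 := by positivity
    rw [searchState]
    set s := searchState φ β B θ t with hs
    have hcount' : (∀ i < t + 1, ¬ (searchState φ β B θ i).Resting β) → t ≤ (φ + 1) * j + s.k :=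
      fun hi => hcount fun i hit => hi i (hit.trans (Nat.lt_succ_self t))
    unfold SearchState.next
    split_ifs with h1 h2 h3 h4
    · exact ⟨j, ⟨h.budget_eq, h.length_eq, h.started, h.previous, h.lo_le, h.lt_up⟩,
        fun hi => absurd h1 (hi t (Nat.lt_succ_self t))⟩
    · rw [SearchState.action, if_pos h1] at h2
      exact absurd h.lo_le h2
    -- The last grid point is the upper end, which exceeds `θ`, so it cannot be accepted.
    · rw [SearchState.action, if_neg h1, h4, mul_div_cancel₀ _ hφ0, add_sub_cancel,
        ← hw.up_eq] at h3
      exact absurd h3 h.lt_up.not_ge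
    · refine ⟨j, ⟨h.budget_eq, h.length_eq, fun _ => ?_, h.previous, h3, h.lt_up⟩,
        fun hi => ?_⟩
      · rcases Nat.eq_zero_or_pos s.k with hk | hk
        · have h5 : ¬ (s.up - s.lo ≤ β) := fun h6 => h1 ⟨hk, h6⟩
          rw [hw.up_eq, hw.lo_eq, hk] at h5
          simpa [lt_sub_iff_add_lt] using h5
        · exact h.started hk
      · have := hcount' hi
        dsimp only
        omega
    -- The grid point with `k = 0` is the lower end, which `θ` accepts; a rejection therefore leaves
    -- exactly one grid step.
    · have hk : 0 < s.k := by
        refine Nat.pos_of_ne_zero fun hk => h3 ?_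
        have := h.lo_le
        rw [hw.lo_eq, hk] at this
        simpa [SearchState.action, h1, hk] using this
      have hlen : s.action φ β - s.lo = (s.top - s.base) / φ := by
        rw [SearchState.action, if_neg h1, hw.lo_eq, Nat.cast_sub hk]
        push_cast
        ring
      refine ⟨j + 1, ⟨?_, ?_, by simp, Or.inr ?_, h.lo_le, not_le.1 h3⟩, fun hi => ?_⟩
      · dsimp only
        rw [h.budget_eq]
        push_cast
        ring
      · dsimp only
        rw [hlen, h.length_eq, pow_succ, mul_inv, div_eq_mul_inv]
      · dsimp only
        rw [hlen, mul_div_cancel₀ _ hφ0]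
        exact h.started hk
      · have := hcount' hi
        have := hw.k_le
        dsimp only
        rw [mul_add, mul_one]
        omega

/-- The last round that ended had length `φ^(1-j) > β`, so `j - 1 < log_φ (1/β) ≤ B - 1`. -/
theorem SearchState.AtLevel.level_lt {B j : ℕ} (hφ : 2 ≤ φ) (hβ : 0 < β) (hB : 1 ≤ B)
    (hlog : Real.logb φ (1 / β) + 1 ≤ B) (h : s.AtLevel φ β B θ j) : j < B := by
  rcases h.previous with h0 | h0
  · omega
  have hφ1 : (1 : ℝ) < φ := by exact_mod_cast hφ
  rcases j with _ | j
  · omega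
  rw [h.length_eq, pow_succ, mul_inv_rev, mul_inv_cancel_left₀ (by positivity)] at h0
  have h1 : (φ : ℝ) ^ (j : ℝ) < 1 / β := by
    rw [Real.rpow_natCast, lt_div_iff₀ hβ, mul_comm, ← lt_div_iff₀ (by positivity), one_div]
    exact h0
  rw [← Real.lt_logb_iff_rpow_lt hφ1 (by positivity)] at h1
  have h2 : (j : ℝ) + 1 < B := by linarith
  exact_mod_cast h2

/-- Every threshold is located, up to `β`, before the budget is used up. -/
theorem finalState_spec (hφ : 2 ≤ φ) (hβ : 0 < β) {B : ℕ} (hB : 1 ≤ B)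
    (hlog : Real.logb φ (1 / β) + 1 ≤ B) (hθ : θ ∈ Ioo (0 : ℝ) 1) :
    Located φ β B θ ∧ (finalState φ β B θ).lo ≤ θ ∧ θ ≤ (finalState φ β B θ).lo + β := by
  have hne : {t : ℕ | (searchState φ β B θ t).budget < 0 ∨
      (searchState φ β B θ t).Resting β}.Nonempty := by
    by_contra hcon
    rw [not_nonempty_iff_eq_empty] at hcon
    have hno : ∀ t, ¬ (searchState φ β B θ t).Resting β := fun t ht => by
      have : t ∈ (∅ : Set ℕ) := hcon ▸ Or.inr ht
      exact this
    -- A search that has not rested by time `(φ + 1) B` would need `(φ + 1) B ≤ (φ + 1) j + φ`,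
    -- impossible for `j < B`.
    obtain ⟨j, h, hcount⟩ := exists_atLevel (β := β) hφ hθ B ((φ + 1) * B)
    have h1 := hcount fun i _ => hno i
    have h2 := h.level_lt hφ hβ hB hlog
    have h3 := (wellFormed_searchState (β := β) hφ B θ ((φ + 1) * B)).k_le
    have h4 : (φ + 1) * (j + 1) ≤ (φ + 1) * B := Nat.mul_le_mul_left _ h2
    rw [mul_add, mul_one] at h4
    omega
  have hmem := Nat.sInf_mem hne
  rw [mem_ofPred_eq] at hmem
  unfold Located finalState
  set T := sInf {t : ℕ | (searchState φ β B θ t).budget < 0 ∨ (searchState φ β B θ t).Resting β}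
  obtain ⟨j, h, -⟩ := exists_atLevel (β := β) hφ hθ B T
  have h2 := h.level_lt hφ hβ hB hlog
  have h3 := h.budget_eq
  have h4 : (searchState φ β B θ T).Resting β := hmem.resolve_left (by omega)
  have h5 := h4.2
  have h6 := h.lt_up
  exact ⟨h5, h.lo_le, by linarith⟩

end Search

/-! ### The empirical distribution function -/

open Classical in
/-- The empirical distribution function of a finite sample. -/
noncomputable def sampleCdf {L : ℕ} (θ : Fin L → ℝ) (x : ℝ) : ℝ :=
  ((Finset.univ.filter fun n => θ n ≤ x).card : ℝ) / L

theorem sampleCdf_mono {L : ℕ} (θ : Fin L → ℝ) : Monotone (sampleCdf θ) := by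
  intro x y hxy
  unfold sampleCdf
  gcongr with n hn

theorem locatedCount_eq {φ : ℕ} {β : ℝ} (hφ : 2 ≤ φ) (hβ : 0 < β) {B : ℕ} (hB : 1 ≤ B)
    (hlog : Real.logb φ (1 / β) + 1 ≤ B) {L : ℕ} {θ : Fin L → ℝ}
    (hθ : ∀ n, θ n ∈ Ioo (0 : ℝ) 1) : locatedCount φ β B θ = L := by
  classical
  unfold locatedCount
  rw [Finset.filter_true_of_mem fun n _ => (finalState_spec hφ hβ hB hlog (hθ n)).1]
  simp

/-- Located users satisfy `lo ≤ θ ≤ lo + β`, so `θ ≤ x` implies `lo ≤ x`, which implies `θ ≤ x + β`.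
-/
theorem empCdf_mem {φ : ℕ} {β : ℝ} (hφ : 2 ≤ φ) (hβ : 0 < β) {B : ℕ} (hB : 1 ≤ B)
    (hlog : Real.logb φ (1 / β) + 1 ≤ B) {L : ℕ} {θ : Fin L → ℝ}
    (hθ : ∀ n, θ n ∈ Ioo (0 : ℝ) 1) (x : ℝ) :
    empCdf φ β B θ x ∈ Icc (sampleCdf θ x) (sampleCdf θ (x + β)) := by
  classical
  have hspec := fun n => finalState_spec hφ hβ hB hlog (hθ n)
  unfold empCdf sampleCdf
  rw [locatedCount_eq hφ hβ hB hlog hθ]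
  constructor
  · gcongr with n hn
    exact fun hx => ⟨(hspec n).1, (hspec n).2.1.trans hx⟩
  · gcongr with n hn
    rintro ⟨-, hx⟩
    linarith [(hspec n).2.2]

/-! ### Uniform accuracy of the estimated distribution function -/

section Concentration

theorem sampleCdf_eq_sum {L : ℕ} (θ : Fin L → ℝ) (x : ℝ) :
    sampleCdf θ x = (∑ n, (Iic x).indicator (fun _ => (1 : ℝ)) (θ n)) / L := by
  classical
  rw [sampleCdf, Finset.card_filter]
  push_cast
  congr 1

theorem measurable_indicator_Iic (x : ℝ) : Measurable ((Iic x).indicator fun _ => (1 : ℝ)) :=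
  measurable_const.indicator measurableSet_Iic

theorem measurable_sampleCdf {L : ℕ} (x : ℝ) :
    Measurable fun θ : Fin L → ℝ => sampleCdf θ x := by
  simp only [sampleCdf_eq_sum]
  exact (Finset.measurable_fun_sum _ fun n _ =>
    (measurable_indicator_Iic x).comp (measurable_pi_apply n)).div_const _

/-- Samples in the unit interval whose empirical distribution function is accurate up to `t` at the
points `i / L`. -/
def accurateSamples (μ : Measure ℝ) (L : ℕ) (t : ℝ) : Set (Fin L → ℝ) :=
  {θ | (∀ n, θ n ∈ Ioo (0 : ℝ) 1) ∧
    ∀ i ∈ Finset.range (L + 1), |sampleCdf θ (i / L) - cdf μ (i / L)| < t}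

theorem measurableSet_accurateSamples (μ : Measure ℝ) (L : ℕ) (t : ℝ) :
    MeasurableSet (accurateSamples μ L t) := by
  have : accurateSamples μ L t = (⋂ n, (fun θ : Fin L → ℝ => θ n) ⁻¹' Ioo (0 : ℝ) 1) ∩
      ⋂ i ∈ Finset.range (L + 1),
        (fun θ : Fin L → ℝ => |sampleCdf θ (i / L) - cdf μ (i / L)|) ⁻¹' Iio t := by
    ext θ
    simp [accurateSamples]
  rw [this]
  refine (MeasurableSet.iInter fun n => measurable_pi_apply n measurableSet_Ioo).inter
    (MeasurableSet.biInter (Finset.countable_toSet _) fun i _ => ?_)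
  have h : Measurable fun θ : Fin L → ℝ => |sampleCdf θ (i / L) - cdf μ (i / L)| :=
    ((measurable_sampleCdf _).sub_const _).norm
  exact h measurableSet_Iio

theorem abs_empCdf_sub_le {μ : Measure ℝ} {Lc Lh : ℝ} (hμ : IsThresholdLaw μ Lc Lh) {φ : ℕ} {β : ℝ}
    (hφ : 2 ≤ φ) (hβ : 0 < β) {B : ℕ} (hB : 1 ≤ B) (hlog : Real.logb φ (1 / β) + 1 ≤ B) {L : ℕ}
    (hL : 1 ≤ L) (hLh : 0 ≤ Lh) {t : ℝ} {θ : Fin L → ℝ} (hθ : θ ∈ accurateSamples μ L t) {x : ℝ}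
    (hx : x ∈ Icc (0 : ℝ) 1) :
    |empCdf φ β B θ x - cdf μ x| ≤ t + Lh * β + Lh / L := by
  have hL0 : (0 : ℝ) < L := by exact_mod_cast hL
  obtain ⟨hlow, hup⟩ := empCdf_mem hφ hβ hB hlog hθ.1 x
  have hmono := sampleCdf_mono θ
  have hLβ : 0 ≤ Lh * β := by positivity
  have hgrid : ∀ i : ℕ, i ≤ L → (i / L : ℝ) ∈ Icc (0 : ℝ) 1 ∧
      |sampleCdf θ (i / L) - cdf μ (i / L)| < t := fun i hi =>
    ⟨⟨by positivity, div_le_one_of_le₀ (Nat.cast_le.2 hi) hL0.le⟩,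
      hθ.2 i (Finset.mem_range.2 (Nat.lt_succ_of_le hi))⟩
  rw [abs_le]
  constructor
  · have hfl := Nat.floor_le (mul_nonneg hx.1 hL0.le)
    have hfl' := Nat.lt_floor_add_one (x * L)
    set i := ⌊x * L⌋₊
    have hiL : i ≤ L := by
      have : (i : ℝ) ≤ L := hfl.trans (mul_le_of_le_one_left hL0.le hx.2)
      exact_mod_cast this
    obtain ⟨hi1, hi2⟩ := hgrid i hiL
    have hix : (i / L : ℝ) ≤ x := (div_le_iff₀ hL0).2 hfl
    have hxi : x - i / L ≤ 1 / L := by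
      rw [sub_le_iff_le_add, ← add_div, le_div_iff₀ hL0]
      linarith
    have h1 := hμ.upper _ hi1 x hx hix
    have h2 := hmono hix
    have h3 := mul_le_mul_of_nonneg_left hxi hLh
    rw [mul_one_div] at h3
    have h4 := (abs_lt.1 hi2).1
    linarith
  -- `x + β` may leave the unit interval; truncating at `1` does not change the sample count because
  -- all thresholds are below `1`.
  · set z := min (x + β) 1 with hz
    have hxz : x ≤ z := le_min (by linarith) hx.2
    have hz1 : z ∈ Icc (0 : ℝ) 1 := ⟨hx.1.trans hxz, min_le_right _ _⟩
    have hsz : sampleCdf θ (x + β) ≤ sampleCdf θ z := by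
      unfold sampleCdf
      refine div_le_div_of_nonneg_right (Nat.cast_le.2 (Finset.card_le_card fun n hn => ?_)) hL0.le
      simp only [Finset.mem_filter, Finset.mem_univ, true_and] at hn ⊢
      exact le_min hn (hθ.1 n).2.le
    have hce := Nat.le_ceil (z * L)
    have hce' := Nat.ceil_lt_add_one (mul_nonneg hz1.1 hL0.le)
    have hiL : ⌈z * L⌉₊ ≤ L := Nat.ceil_le.2 (mul_le_of_le_one_left hL0.le hz1.2)
    set i := ⌈z * L⌉₊
    obtain ⟨hi1, hi2⟩ := hgrid i hiL
    have hzi : z ≤ i / L := (le_div_iff₀ hL0).2 hce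
    have hiz : i / L - x ≤ β + 1 / L := by
      have h1 : (i : ℝ) / L ≤ z + 1 / L := by
        rw [div_le_iff₀ hL0, add_mul, one_div, inv_mul_cancel₀ hL0.ne']
        exact hce'.le
      have h2 : z ≤ x + β := min_le_left _ _
      linarith
    have h1 := hμ.upper x hx _ hi1 (hxz.trans hzi)
    have h2 := hmono hzi
    have h3 := mul_le_mul_of_nonneg_left hiz hLh
    rw [mul_add, mul_one_div] at h3
    have h4 := (abs_lt.1 hi2).2
    linarith

variable {μ : Measure ℝ} [IsProbabilityMeasure μ]

/-- Hoeffding's inequality for the empirical distribution function at a point. -/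
theorem sampleCdf_tail {L : ℕ} (hL : 1 ≤ L) (x : ℝ) {t : ℝ} (ht : 0 ≤ t) :
    (Measure.pi fun _ : Fin L => μ).real {θ | t ≤ |sampleCdf θ x - cdf μ x|} ≤
      2 * Real.exp (-(2 * L * t ^ 2)) := by
  have hL0 : (0 : ℝ) < L := by exact_mod_cast hL
  set ν := Measure.pi fun _ : Fin L => μ
  let f : ℝ → ℝ := fun z => (Iic x).indicator (fun _ => (1 : ℝ)) z - cdf μ x
  have hf : Measurable f := (measurable_indicator_Iic x).sub_const _
  have hint : ∫ z, (Iic x).indicator (fun _ => (1 : ℝ)) z ∂μ = cdf μ x := by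
    rw [integral_indicator measurableSet_Iic, cdf_eq_real]
    simp
  have hsub : HasSubgaussianMGF f (1 / 4) μ := by
    -- A variable with values in an interval of length `1` has variance proxy `1/4`; the sum of `L`
    -- independent ones has `L / 4`.
    have h := hasSubgaussianMGF_of_mem_Icc (μ := μ) (a := 0) (b := 1)
      (measurable_indicator_Iic x).aemeasurable (ae_of_all _ fun z => by
        by_cases hz : z ∈ Iic x <;> simp [hz])
    rw [hint] at h
    convert h using 1
    ext
    norm_num
  have hsum : HasSubgaussianMGF (fun θ : Fin L → ℝ => ∑ n, f (θ n)) (L / 4) ν := by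
    have hind : iIndepFun (fun (n : Fin L) (θ : Fin L → ℝ) => f (θ n)) ν :=
      iIndepFun_pi fun _ => hf.aemeasurable
    have h := HasSubgaussianMGF.sum_of_iIndepFun hind (c := fun _ => 1 / 4) (s := Finset.univ)
      fun n _ => by
        have he := (measurePreserving_eval (fun _ : Fin L => μ) n)
        exact HasSubgaussianMGF.of_map (Y := fun θ : Fin L → ℝ => θ n) he.measurable.aemeasurable
          (by rw [he.map_eq]; exact hsub)
    convert h using 1
    simp [div_eq_mul_inv]
  have hset : {θ : Fin L → ℝ | t ≤ |sampleCdf θ x - cdf μ x|} ⊆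
      {θ | L * t ≤ ∑ n, f (θ n)} ∪ {θ | L * t ≤ (-fun θ : Fin L → ℝ => ∑ n, f (θ n)) θ} := by
    intro θ hθ
    have h : ∑ n, f (θ n) = L * (sampleCdf θ x - cdf μ x) := by
      rw [sampleCdf_eq_sum, mul_sub, mul_div_cancel₀ _ hL0.ne']
      simp [f, Finset.sum_sub_distrib]
    simp only [mem_union, mem_ofPred_eq, Pi.neg_apply, h] at hθ ⊢
    rcases le_abs.1 hθ with h1 | h1
    · exact Or.inl (mul_le_mul_of_nonneg_left h1 hL0.le)
    · right
      rw [← mul_neg]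
      exact mul_le_mul_of_nonneg_left h1 hL0.le
  have hexp : -(L * t) ^ 2 / (2 * ((L / 4 : NNReal) : ℝ)) = -(2 * L * t ^ 2) := by
    push_cast
    field_simp
    ring
  have h1 := hsum.measure_ge_le (ε := L * t) (by positivity)
  have h2 := hsum.neg.measure_ge_le (ε := L * t) (by positivity)
  rw [hexp] at h1 h2
  refine (measureReal_mono hset).trans ((measureReal_union_le _ _).trans ?_)
  linarith

theorem le_measure_accurateSamples {Lc Lh : ℝ} (hμ : IsThresholdLaw μ Lc Lh) {L : ℕ} (hL : 1 ≤ L)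
    {t ε : ℝ} (ht : 0 ≤ t) (h : (L + 1) * (2 * Real.exp (-(2 * L * t ^ 2))) ≤ ε) :
    ENNReal.ofReal (1 - ε) ≤ (Measure.pi fun _ : Fin L => μ) (accurateSamples μ L t) := by
  set ν := Measure.pi fun _ : Fin L => μ
  have hm := measurableSet_accurateSamples μ L t
  have hunit : ∀ᵐ θ ∂ν, ∀ n, θ n ∈ Ioo (0 : ℝ) 1 := by
    rw [ae_all_iff]
    exact fun n => (measurePreserving_eval (fun _ : Fin L => μ) n).quasiMeasurePreserving.ae
      hμ.ae_mem
  have hcompl : ν.real (accurateSamples μ L t)ᶜ ≤ ε := by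
    have hsub : ν.real (accurateSamples μ L t)ᶜ ≤
        ν.real (⋃ i ∈ Finset.range (L + 1),
          {θ | t ≤ |sampleCdf θ (i / L) - cdf μ (i / L)|}) := by
      refine ENNReal.toReal_mono (measure_ne_top _ _) (measure_mono_ae ?_)
      filter_upwards [hunit] with θ hθ hc
      by_contra hcon
      refine hc ⟨hθ, fun i hi => lt_of_not_ge fun h => hcon ?_⟩
      exact mem_biUnion (x := i) hi h
    refine hsub.trans ((measureReal_biUnion_finset_le _ _).trans ?_)
    refine (Finset.sum_le_sum fun i _ => sampleCdf_tail hL _ ht).trans ?_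
    rw [Finset.sum_const, Finset.card_range, nsmul_eq_mul]
    push_cast
    exact h
  have h1 := probReal_compl_eq_one_sub (μ := ν) hm
  rw [← ofReal_measureReal]
  exact ENNReal.ofReal_le_ofReal (by linarith)

end Concentration

/-- The confidence bound is close to the true probability of a positive feedback. -/
theorem abs_ucbProb_sub_condProb_le {F Fh : ℝ → ℝ} {e η β δ Lc Lh : ℝ} (hδ : 0 < δ) (hLc : 0 < Lc)
    (hmono : Monotone F)
    (hlower : ∀ x ∈ Icc (0 : ℝ) 1, ∀ y ∈ Icc (0 : ℝ) 1, x ≤ y → Lc * (y - x) ≤ F y - F x)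
    (hF : ∀ x ∈ Icc (0 : ℝ) 1, |Fh x - F x| ≤ e) (hη : 0 ≤ η + 2 * β * Lh) {s : UIState}
    (hs : s.Valid) (hl : δ < s.up - s.lo) {y : ℝ} (hy : y ∈ Icc s.lo s.up) :
    |ucbProb Fh η β δ Lc Lh s y - condProb F s y| ≤
      (4 * e + 2 * (η + 2 * β * Lh)) / (Lc * δ) := by
  have hlo := hs.mem_unit hs.lo_mem
  have hup := hs.mem_unit ⟨hs.2.1, le_rfl⟩
  have hu := abs_le.1 (hF _ hup)
  have hl' := abs_le.1 (hF _ hlo)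
  have hy' := abs_le.1 (hF _ (hs.mem_unit hy))
  have hLl := hlower _ hlo _ hup hs.2.1
  have hD : Lc * δ ≤ Lc * (s.up - s.lo) := mul_le_mul_of_nonneg_left hl.le hLc.le
  have hLcδ : 0 < Lc * δ := mul_pos hLc hδ
  have hp := condProb_mem hmono hy
  set A := F s.up - F s.lo with hA
  set A' := max (Fh s.up - Fh s.lo) (Lc * (s.up - s.lo)) with hA'
  have hA0 : 0 < A := by linarith
  have hA'0 : Lc * δ ≤ A' := hD.trans (le_max_right _ _)
  have hAA : |A' - A| ≤ 2 * e := by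
    rw [abs_le]
    have h1 : Fh s.up - Fh s.lo ≤ A' := le_max_left _ _
    have h2 : A' ≤ A + 2 * e := max_le (by linarith) (by linarith)
    constructor <;> linarith
  have hy2 : |(Fh s.up - Fh y) - (F s.up - F y)| ≤ 2 * e := by
    rw [abs_le]; constructor <;> linarith
  have hfrac : |(Fh s.up - Fh y) / A' - condProb F s y| ≤ 4 * e / (Lc * δ) := by
    have hA'p : 0 < A' := hLcδ.trans_le hA'0
    -- Writing the true numerator as `condProb * A` turns the difference of quotients into one
    -- fraction over `A' ≥ Lc δ`; as `condProb ≤ 1`, numerator and denominator contribute `2 e`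
    -- each.
    have heq : (Fh s.up - Fh y) / A' - condProb F s y =
        (((Fh s.up - Fh y) - (F s.up - F y)) - condProb F s y * (A' - A)) / A' := by
      have : condProb F s y * A = F s.up - F y := by
        rw [condProb, div_mul_cancel₀ _ hA0.ne']
      field_simp
      linarith
    rw [heq, abs_div, abs_of_pos hA'p]
    have h1 : |condProb F s y * (A' - A)| ≤ 2 * e := by
      rw [abs_mul, abs_of_nonneg hp.1]
      exact (mul_le_of_le_one_left (abs_nonneg _) hp.2).trans hAA
    have h2 := abs_sub ((Fh s.up - Fh y) - (F s.up - F y)) (condProb F s y * (A' - A))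
    have he : 0 ≤ e := by linarith [abs_nonneg (A' - A)]
    exact div_le_div₀ (by linarith) (by linarith) hLcδ hA'0
  have hw : 0 ≤ 2 * (η + 2 * β * Lh) / (Lc * δ) := by positivity
  rw [ucbProb, add_div, add_sub_right_comm]
  refine (abs_add_le _ _).trans ?_
  rw [abs_of_nonneg hw]
  linarith

/-! ### Rates -/

section Rates

/-- Used with `l = log 2` and `b = log N` to express every error term as a constant times `√(log N /
L)`. -/
theorem sqrt_div_le {a b l x : ℝ} (hl : 0 < l) (ha : 0 ≤ a) (hx : 0 < x) (hlb : l ≤ b) :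
    √(a / x) ≤ √(a / l) * √(b / x) := by
  rw [← Real.sqrt_mul (by positivity)]
  refine Real.sqrt_le_sqrt ?_
  rw [div_mul_div_comm]
  rw [div_le_div_iff₀ hx (by positivity)]
  have := mul_le_mul_of_nonneg_left hlb (mul_nonneg ha hx.le)
  nlinarith

theorem log_two_le_log {N : ℕ} (hN : 2 ≤ N) : Real.log 2 ≤ Real.log N :=
  Real.log_le_log two_pos (by exact_mod_cast hN)

theorem rpow_two_thirds_le {N B : ℕ} (hN : 2 ≤ N) (hB : 1 ≤ B) :
    (N : ℝ) ^ (2 / 3 : ℝ) ≤ (Real.log 2 ^ (2 / 3 : ℝ))⁻¹ *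
      ((N : ℝ) ^ (2 / 3 : ℝ) * (B : ℝ) ^ (1 / 6 : ℝ) * Real.log N ^ (2 / 3 : ℝ)) := by
  have hl : 0 < Real.log 2 := Real.log_pos one_lt_two
  have h1 : (1 : ℝ) ≤ (B : ℝ) ^ (1 / 6 : ℝ) :=
    Real.one_le_rpow (by exact_mod_cast hB) (by norm_num)
  have h2 : Real.log 2 ^ (2 / 3 : ℝ) ≤ Real.log N ^ (2 / 3 : ℝ) :=
    Real.rpow_le_rpow hl.le (log_two_le_log hN) (by norm_num)
  have h3 : 0 < Real.log 2 ^ (2 / 3 : ℝ) := Real.rpow_pos_of_pos hl _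
  rw [inv_mul_eq_div, le_div_iff₀ h3]
  have h4 : 0 ≤ (N : ℝ) ^ (2 / 3 : ℝ) := by positivity
  calc (N : ℝ) ^ (2 / 3 : ℝ) * Real.log 2 ^ (2 / 3 : ℝ)
      ≤ (N : ℝ) ^ (2 / 3 : ℝ) * Real.log N ^ (2 / 3 : ℝ) := by gcongr
    _ ≤ (N : ℝ) ^ (2 / 3 : ℝ) * (B : ℝ) ^ (1 / 6 : ℝ) * Real.log N ^ (2 / 3 : ℝ) := by
        gcongr
        exact le_mul_of_one_le_right h4 h1

/-- The lower bound on `L` gives `(log N)^(1/2)`; the missing factor `(log N)^(1/6)` is at least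
`(log 2)^(1/6)`. -/
theorem mul_sqrt_log_div_le {N B L : ℕ} {c : ℝ} (hN : 2 ≤ N) (hB : 1 ≤ B) (hc : 0 < c)
    (hL : c * (N : ℝ) ^ (2 / 3 : ℝ) / (B : ℝ) ^ (1 / 3 : ℝ) ≤ L) :
    (N : ℝ) * √(Real.log N / L) ≤ √(1 / c) * (Real.log 2 ^ (1 / 6 : ℝ))⁻¹ *
      ((N : ℝ) ^ (2 / 3 : ℝ) * (B : ℝ) ^ (1 / 6 : ℝ) * Real.log N ^ (2 / 3 : ℝ)) := by
  have hl : 0 < Real.log 2 := Real.log_pos one_lt_two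
  have hlN := log_two_le_log hN
  have hlN0 : 0 < Real.log N := hl.trans_le hlN
  have hN0 : (0 : ℝ) < N := by positivity
  have hB0 : (0 : ℝ) < B := by positivity
  have h1 : √(Real.log N / L) ≤ √(1 / c) * (N : ℝ) ^ (-(1 / 3) : ℝ) * (B : ℝ) ^ (1 / 6 : ℝ) *
      Real.log N ^ (1 / 2 : ℝ) := by
    refine Real.sqrt_le_iff.2 ⟨by positivity, ?_⟩
    have e1 : ((N : ℝ) ^ (-(1 / 3) : ℝ)) ^ 2 = ((N : ℝ) ^ (2 / 3 : ℝ))⁻¹ := by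
      rw [← Real.rpow_natCast, ← Real.rpow_mul hN0.le, ← Real.rpow_neg hN0.le]; norm_num
    have e2 : ((B : ℝ) ^ (1 / 6 : ℝ)) ^ 2 = (B : ℝ) ^ (1 / 3 : ℝ) := by
      rw [← Real.rpow_natCast, ← Real.rpow_mul hB0.le]; norm_num
    have e3 : (Real.log N ^ (1 / 2 : ℝ)) ^ 2 = Real.log N := by
      rw [← Real.rpow_natCast, ← Real.rpow_mul hlN0.le]; norm_num
    rw [mul_pow, mul_pow, mul_pow, e1, e2, e3, Real.sq_sqrt (by positivity)]
    refine (div_le_div_of_nonneg_left hlN0.le (by positivity) hL).trans_eq ?_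
    field_simp
  have h2 : (N : ℝ) * (N : ℝ) ^ (-(1 / 3) : ℝ) = (N : ℝ) ^ (2 / 3 : ℝ) := by
    rw [← Real.rpow_one_add' hN0.le (by norm_num)]; norm_num
  have h3 : Real.log N ^ (1 / 2 : ℝ) ≤
      (Real.log 2 ^ (1 / 6 : ℝ))⁻¹ * Real.log N ^ (2 / 3 : ℝ) := by
    have : Real.log N ^ (2 / 3 : ℝ) = Real.log N ^ (1 / 2 : ℝ) * Real.log N ^ (1 / 6 : ℝ) := by
      rw [← Real.rpow_add hlN0]; norm_num
    have h4 : Real.log 2 ^ (1 / 6 : ℝ) ≤ Real.log N ^ (1 / 6 : ℝ) :=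
      Real.rpow_le_rpow hl.le hlN (by norm_num)
    rw [inv_mul_eq_div, le_div_iff₀ (by positivity), this]
    gcongr
  calc (N : ℝ) * √(Real.log N / L)
      ≤ N * (√(1 / c) * (N : ℝ) ^ (-(1 / 3) : ℝ) * (B : ℝ) ^ (1 / 6 : ℝ) *
          Real.log N ^ (1 / 2 : ℝ)) := by gcongr
    _ = √(1 / c) * (N * (N : ℝ) ^ (-(1 / 3) : ℝ)) * (B : ℝ) ^ (1 / 6 : ℝ) *
          Real.log N ^ (1 / 2 : ℝ) := by ring
    _ ≤ √(1 / c) * (N : ℝ) ^ (2 / 3 : ℝ) * (B : ℝ) ^ (1 / 6 : ℝ) *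
          ((Real.log 2 ^ (1 / 6 : ℝ))⁻¹ * Real.log N ^ (2 / 3 : ℝ)) := by rw [h2]; gcongr
    _ = _ := by ring

/-- The accuracy at the points `i / L` that the empirical distribution function of `L` users has
with probability `1 - ε`. -/
noncomputable def sampleAccuracy (ε : ℝ) (L : ℕ) : ℝ := √(Real.log (2 * (L + 1) / ε) / (2 * L))

theorem union_bound_sampleAccuracy {ε : ℝ} (hε0 : 0 < ε) (hε1 : ε < 1) {L : ℕ} (hL : 1 ≤ L) :
    (L + 1) * (2 * Real.exp (-(2 * L * sampleAccuracy ε L ^ 2))) ≤ ε := by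
  have hL0 : (0 : ℝ) < L := by exact_mod_cast hL
  have h1 : 1 ≤ 2 * (L + 1) / ε := by rw [le_div_iff₀ hε0]; linarith
  rw [sampleAccuracy, Real.sq_sqrt (div_nonneg (Real.log_nonneg h1) (by positivity)),
    mul_div_cancel₀ _ (by positivity), Real.exp_neg, Real.exp_log (by positivity)]
  refine le_of_eq ?_
  field_simp

theorem sampleAccuracy_le {ε : ℝ} (hε0 : 0 < ε) (hε1 : ε < 1) {L N : ℕ} (hL : 1 ≤ L) (hLN : L ≤ N)
    (hN : 2 ≤ N) :
    sampleAccuracy ε L ≤ √((Real.log (2 / ε) / Real.log 2 + 2) / 2) * √(Real.log N / L) := by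
  have hl : 0 < Real.log 2 := Real.log_pos one_lt_two
  have hlN := log_two_le_log hN
  have hL0 : (0 : ℝ) < L := by exact_mod_cast hL
  have hN0 : (2 : ℝ) ≤ N := by exact_mod_cast hN
  have hLN' : (L : ℝ) ≤ N := by exact_mod_cast hLN
  have hε2 : 0 ≤ Real.log (2 / ε) := Real.log_nonneg (by rw [le_div_iff₀ hε0]; linarith)
  rw [sampleAccuracy, ← Real.sqrt_mul (by positivity)]
  refine Real.sqrt_le_sqrt ?_
  -- The union bound over `L + 1` points costs only `2 log N`, because `L + 1 ≤ N + 1 ≤ N²` for `N ≥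
  -- 2`.
  have h1 : Real.log (2 * (L + 1) / ε) ≤ Real.log (2 / ε) + 2 * Real.log N := by
    rw [← Real.log_rpow (by linarith), ← Real.log_mul (by positivity) (by positivity)]
    refine Real.log_le_log (by positivity) ?_
    rw [div_mul_eq_mul_div]
    norm_cast
    gcongr
    nlinarith
  have h2 : Real.log (2 / ε) ≤ Real.log (2 / ε) / Real.log 2 * Real.log N := by
    rw [div_mul_eq_mul_div, le_div_iff₀ hl]
    gcongr
  rw [div_mul_div_comm]
  gcongr
  linarith

theorem one_div_le_sqrt {x : ℝ} (hx : 1 ≤ x) : 1 / x ≤ √(1 / x) := by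
  refine Real.le_sqrt_of_sq_le ?_
  have : 1 / x ≤ 1 := by rw [div_le_one (by linarith)]; exact hx
  have : 0 ≤ 1 / x := by positivity
  nlinarith

end Rates

end SeqChoice

/-! ### Choice of constants and proof of the regret bound -/

open SeqChoice
/-- The `δ`-regret of UCB-PVI-HF. In the last two lines the reward of the exploration users is first
the realized one (regret conditional on the exploration data), then the expected one. -/
theorem theorem10
    (γ δ ε Lr Lc Lh rmax lamBar : ℝ) (φ : ℕ)
    (hγ0 : 0 ≤ γ) (hγ1 : γ < 1) (hδ : 0 < δ) (hε0 : 0 < ε) (hε1 : ε < 1)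
    (hLr : 0 < Lr) (hLc : 0 < Lc) (hLcLh : Lc ≤ Lh) (hlam : lamBar < 1) (hφ : 2 ≤ φ) :
    ∃ M : ℝ, 0 < M ∧
      ∀ (r : ℝ → ℝ) (μ : Measure ℝ) [IsProbabilityMeasure μ],
        IsReward r Lr rmax → IsThresholdLaw μ Lc Lh →
      ∀ (N B L : ℕ) (lam β τ : ℝ),
        2 ≤ N → 1 ≤ B → 1 ≤ L → L ≤ N → 0 ≤ lam → lam ≤ lamBar →
        |(L : ℝ) - (Real.log (16 / ε)) ^ (1 / 2 : ℝ) * (N : ℝ) ^ (2 / 3 : ℝ) *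
            (1 - lam) ^ (1 / 2 : ℝ) / (B : ℝ) ^ (1 / 3 : ℝ)| < 1 →
        β = eta ε L / (2 * Lh) → β < 1 → Real.logb φ (1 / β) + 1 ≤ B →
        0 ≤ τ → τ ≤ (N : ℝ) ^ (-(1 / 3) : ℝ) →
      ∀ (V ystar : UIState → ℝ),
        IsOptimalValue γ r (cdf μ) V → IsOptimalAction γ r (cdf μ) V ystar →
      ∃ G : Set (Fin L → ℝ), MeasurableSet G ∧
        ENNReal.ofReal (1 - ε) ≤ (Measure.pi fun _ : Fin L => μ) G ∧
        ∀ θ ∈ G, ∀ yhat : UIState → ℝ,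
          IsUCBPVIAction γ δ ε τ Lc Lh r φ β B θ yhat →
          deltaRegret γ δ r μ ystar N L B
              (∑ n, searchReward γ r φ β B (θ n)) (deltaPolicy δ yhat)
            ≤ M * (N : ℝ) ^ (2 / 3 : ℝ) * (B : ℝ) ^ (1 / 6 : ℝ) *
                (Real.log N) ^ (2 / 3 : ℝ) ∧
          deltaRegret γ δ r μ ystar N L B
              (∫ θ' : Fin L → ℝ, ∑ n, searchReward γ r φ β B (θ' n) ∂(Measure.pi fun _ => μ))
              (deltaPolicy δ yhat)
            ≤ M * (N : ℝ) ^ (2 / 3 : ℝ) * (B : ℝ) ^ (1 / 6 : ℝ) *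
                (Real.log N) ^ (2 / 3 : ℝ) := by
  -- For `rmax < 0` there is no admissible reward function, so any positive constant works.
  rcases lt_or_ge rmax 0 with hneg | hr0
  · exact ⟨1, one_pos, fun r μ _ hr => absurd hr.rmax_nonneg hneg.not_ge⟩
  have h1γ : 0 < 1 - γ := sub_pos.2 hγ1
  have hLh : 0 < Lh := hLc.trans_le hLcLh
  have hl2 : 0 < Real.log 2 := Real.log_pos one_lt_two
  have hl16 : 0 < Real.log (16 / ε) := Real.log_pos (by rw [lt_div_iff₀ hε0]; linarith)
  have hlam' : 0 < 1 - lamBar := sub_pos.2 hlam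
  set ρ := rmax / (1 - γ) with hρ
  have hρ0 : 0 ≤ ρ := by positivity
  -- With `t` the sample accuracy, `e = t + Lh β + Lh / L` and `Lh β = η / 2`, the bound `4 e + 2 (η
  -- + 2 β Lh)` equals `4 t + 6 η + 4 Lh / L`.
  set Cκ : ℝ := (4 * √((Real.log (2 / ε) / Real.log 2 + 2) / 2) +
    6 * √(18 * Real.log (16 / ε) / Real.log 2) + 4 * Lh * √(1 / Real.log 2)) / (Lc * δ) with hCκ
  have hCκ0 : 0 ≤ Cκ := by positivity
  set c : ℝ := Real.log (16 / ε) ^ (1 / 2 : ℝ) * (1 - lamBar) ^ (1 / 2 : ℝ) / 2 with hc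
  have hc0 : 0 < c := by positivity
  set Rv : ℝ := rmax + 2 * (4 * rmax / (1 - γ)) with hRv
  have hRv0 : 0 ≤ Rv := by positivity
  set C₁ : ℝ := (Real.log 2 ^ (2 / 3 : ℝ))⁻¹ with hC₁
  set C₂ : ℝ := √(1 / c) * (Real.log 2 ^ (1 / 6 : ℝ))⁻¹ with hC₂
  have hC₁0 : 0 ≤ C₁ := by positivity
  have hC₂0 : 0 ≤ C₂ := by positivity
  -- The term `2 * Rv` serves accurate estimates. The term `4 * ρ` serves `κ > (1 - γ) / 4`, where
  -- the trivial loss satisfies `ρ ≤ 4 κ ρ / (1 - γ)`.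
  set D : ℝ := (2 * Rv + 4 * ρ) / (1 - γ) with hD
  have hD0 : 0 ≤ D := by positivity
  -- The final `+ 1` only makes the constant strictly positive.
  refine ⟨((Real.log (16 / ε) ^ (1 / 2 : ℝ) + 1) * ρ + 1 / (1 - γ)) * C₁ + Cκ * D * C₂ + 1,
    by positivity, ?_⟩
  intro r μ _ hr hμ N B L lam β τ hN hB hL hLN hlam0 hlam1 hLX hβ hβ1 hlog hτ0 hτ V ystar hV hystar
  have hL0 : (1 : ℝ) ≤ L := by exact_mod_cast hL
  have hN0 : (2 : ℝ) ≤ N := by exact_mod_cast hN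
  have hB0 : (1 : ℝ) ≤ B := by exact_mod_cast hB
  have hη0 : 0 < eta ε L := Real.sqrt_pos.2 (by positivity)
  have hβ0 : 0 < β := by rw [hβ]; positivity
  have hβη : Lh * β = eta ε L / 2 := by rw [hβ]; field_simp
  set S := √(Real.log N / L) with hS
  have hS0 : 0 ≤ S := Real.sqrt_nonneg _
  have ht0 : 0 ≤ sampleAccuracy ε L := Real.sqrt_nonneg _
  refine ⟨accurateSamples μ L (sampleAccuracy ε L), measurableSet_accurateSamples _ _ _,
    le_measure_accurateSamples hμ hL ht0 (union_bound_sampleAccuracy hε0 hε1 hL), ?_⟩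
  intro θ hθ yhat hyhat
  have hstarI : ∀ s : UIState, s.Valid → 0 ≤ s.budget → δ < s.up - s.lo →
      ystar s ∈ Icc s.lo s.up := fun s hs hb hl => (hystar s hs (by linarith) hb).1
  have hκ : ∀ s : UIState, s.Valid → δ < s.up - s.lo → ∀ y ∈ Icc s.lo s.up,
      |ucbProb (empCdf φ β B θ) (eta ε (locatedCount φ β B θ)) β δ Lc Lh s y -
        condProb (cdf μ) s y| ≤ Cκ * S := by
    intro s hs hl y hy
    rw [locatedCount_eq hφ hβ0 hB hlog hθ.1]
    refine (abs_ucbProb_sub_condProb_le hδ hLc (monotone_cdf μ) hμ.lower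
      (fun x hx => abs_empCdf_sub_le hμ hφ hβ0 hB hlog hL hLh.le hθ hx) (by positivity)
      hs hl hy).trans ?_
    have h1 := sampleAccuracy_le hε0 hε1 hL hLN hN
    have h2 : eta ε L ≤ √(18 * Real.log (16 / ε) / Real.log 2) * S :=
      sqrt_div_le hl2 (by positivity) (by linarith) (log_two_le_log hN)
    have h3 : 1 / (L : ℝ) ≤ √(1 / Real.log 2) * S :=
      (one_div_le_sqrt hL0).trans (sqrt_div_le hl2 one_pos.le (by linarith) (log_two_le_log hN))
    have h4 : Lh / L ≤ Lh * (√(1 / Real.log 2) * S) := by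
      rw [← mul_one_div]; gcongr
    have h5 : 2 * β * Lh = eta ε L := by linarith
    rw [hCκ, div_mul_eq_mul_div, h5, hβη]
    gcongr
    linarith
  have hloss : deltaValue γ δ r μ ystar B - deltaValue γ δ r μ yhat B ≤
      τ / (1 - γ) + Cκ * S * D := by
    have hκ0 : 0 ≤ Cκ * S := by positivity
    have hsplit : Cκ * S * D = 2 * (Cκ * S * Rv) / (1 - γ) + 4 * (Cκ * S) / (1 - γ) * ρ := by
      rw [hD]; ring
    rcases le_or_gt (Cκ * S) ((1 - γ) / 4) with hsmall | hlarge
    · have h := deltaValue_sub_le hγ0 hγ1 hδ hr hLc hμ hκ0 hsmall hκ hτ0 hyhat hstarI B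
      have h2 : 0 ≤ 4 * (Cκ * S) / (1 - γ) * ρ := by positivity
      rw [add_div] at h
      linarith
    · have h1 := (deltaValue_mem (μ := μ) hγ0 hγ1 hr (admissible_deltaPolicy hstarI) B).2
      have h2 := (deltaValue_mem (μ := μ) hγ0 hγ1 hr (admissible_deltaPolicy hyhat.1) B).1
      have h3 : 0 ≤ 2 * (Cκ * S * Rv) / (1 - γ) := by positivity
      have h4 : 1 ≤ 4 * (Cκ * S) / (1 - γ) := by rw [le_div_iff₀ h1γ]; linarith
      have h5 := le_mul_of_one_le_left hρ0 h4
      have h6 : 0 ≤ τ / (1 - γ) := by positivity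
      linarith
  set Γ := (N : ℝ) ^ (2 / 3 : ℝ) * (B : ℝ) ^ (1 / 6 : ℝ) * Real.log N ^ (2 / 3 : ℝ) with hΓ
  have hΓ0 : 0 ≤ Γ := by
    have := hl2.trans_le (log_two_le_log hN)
    positivity
  have hN23 : (N : ℝ) ^ (2 / 3 : ℝ) ≤ C₁ * Γ := rpow_two_thirds_le hN hB
  have hX := abs_lt.1 hLX
  set X := Real.log (16 / ε) ^ (1 / 2 : ℝ) * (N : ℝ) ^ (2 / 3 : ℝ) *
            (1 - lam) ^ (1 / 2 : ℝ) / (B : ℝ) ^ (1 / 3 : ℝ) with hXdef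
  have hXlow : c * (N : ℝ) ^ (2 / 3 : ℝ) / (B : ℝ) ^ (1 / 3 : ℝ) ≤ L := by
    have h1 : (1 - lamBar) ^ (1 / 2 : ℝ) ≤ (1 - lam) ^ (1 / 2 : ℝ) :=
      Real.rpow_le_rpow hlam'.le (by linarith) (by norm_num)
    have h2 : c * (N : ℝ) ^ (2 / 3 : ℝ) / (B : ℝ) ^ (1 / 3 : ℝ) ≤ X / 2 := by
      have : c * (N : ℝ) ^ (2 / 3 : ℝ) / (B : ℝ) ^ (1 / 3 : ℝ) =
          Real.log (16 / ε) ^ (1 / 2 : ℝ) * (N : ℝ) ^ (2 / 3 : ℝ) *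
            (1 - lamBar) ^ (1 / 2 : ℝ) / (B : ℝ) ^ (1 / 3 : ℝ) / 2 := by rw [hc]; ring
      rw [this, hXdef]
      gcongr
    -- Rounding: `X < L + 1 ≤ 2 L`, which explains the factor `1/2` in `c`.
    linarith
  have hNS : (N : ℝ) * S ≤ C₂ * Γ := mul_sqrt_log_div_le hN hB hc0 hXlow
  have hLup : (L : ℝ) ≤ (Real.log (16 / ε) ^ (1 / 2 : ℝ) + 1) * (C₁ * Γ) := by
    have h1 : (1 - lam) ^ (1 / 2 : ℝ) ≤ 1 := Real.rpow_le_one (by linarith) (by linarith)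
      (by norm_num)
    have h2 : (1 : ℝ) ≤ (B : ℝ) ^ (1 / 3 : ℝ) := Real.one_le_rpow hB0 (by norm_num)
    have h3 : (1 : ℝ) ≤ (N : ℝ) ^ (2 / 3 : ℝ) := Real.one_le_rpow (by linarith) (by norm_num)
    have h4 : X ≤ Real.log (16 / ε) ^ (1 / 2 : ℝ) * (N : ℝ) ^ (2 / 3 : ℝ) :=
      (div_le_self (mul_nonneg (by positivity) (Real.rpow_nonneg (by linarith) _)) h2).trans
        (mul_le_of_le_one_right (by positivity) h1)
    have h5 : (Real.log (16 / ε) ^ (1 / 2 : ℝ) + 1) * (N : ℝ) ^ (2 / 3 : ℝ) ≤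
        (Real.log (16 / ε) ^ (1 / 2 : ℝ) + 1) * (C₁ * Γ) := by gcongr
    linarith
  have hNτ : (N : ℝ) * τ ≤ C₁ * Γ := by
    refine le_trans ?_ hN23
    refine (mul_le_mul_of_nonneg_left hτ (by positivity)).trans_eq ?_
    rw [← Real.rpow_one_add' (by positivity) (by norm_num)]
    norm_num
  -- The exploration reward enters only through its sign, so realized and expected rewards are
  -- handled together.
  have hfinal : ∀ W : ℝ, 0 ≤ W → deltaRegret γ δ r μ ystar N L B W (deltaPolicy δ yhat) ≤
      (((Real.log (16 / ε) ^ (1 / 2 : ℝ) + 1) * ρ + 1 / (1 - γ)) * C₁ + Cκ * D * C₂ + 1) *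
        (N : ℝ) ^ (2 / 3 : ℝ) * (B : ℝ) ^ (1 / 6 : ℝ) * Real.log N ^ (2 / 3 : ℝ) := by
    intro W hW
    have h := deltaRegret_le hγ0 hγ1 hr (admissible_deltaPolicy hstarI)
      (admissible_deltaPolicy hyhat.1) hLN hW (by positivity) hloss
    have h1 := mul_le_mul_of_nonneg_right hLup hρ0
    have h2 := div_le_div_of_nonneg_right hNτ h1γ.le
    have h3 := mul_le_mul_of_nonneg_left hNS (mul_nonneg hCκ0 hD0)
    have h4 : (N : ℝ) * (τ / (1 - γ) + Cκ * S * D) = N * τ / (1 - γ) + Cκ * D * (N * S) := by ring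
    have h5 : (((Real.log (16 / ε) ^ (1 / 2 : ℝ) + 1) * ρ + 1 / (1 - γ)) * C₁ + Cκ * D * C₂ + 1) *
        (N : ℝ) ^ (2 / 3 : ℝ) * (B : ℝ) ^ (1 / 6 : ℝ) * Real.log N ^ (2 / 3 : ℝ) =
        (Real.log (16 / ε) ^ (1 / 2 : ℝ) + 1) * (C₁ * Γ) * ρ + C₁ * Γ / (1 - γ) +
          Cκ * D * (C₂ * Γ) + Γ := by rw [hΓ]; ring
    rw [h5]
    rw [h4] at h
    linarith
  exact ⟨hfinal _ (Finset.sum_nonneg fun n _ => searchReward_nonneg hγ0 hr hφ B (θ n)),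
    hfinal _ (integral_nonneg fun θ' =>
      Finset.sum_nonneg fun n _ => searchReward_nonneg hγ0 hr hφ B (θ' n))⟩
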